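/- Let $V$ be a finite-dimensional real Euclidean space, $\Phi\subset V$ an irreducible (reduced) crystallographic root system, not required to span $V$, and $\Delta$ a simple system with positive system $\Phi^+$ and highest root $\widetilde\alpha$. Put $\alpha^\vee=2\alpha/\langle\alpha,\alpha\rangle$. For $\lambda=(\alpha,n)\in\Phi_a:=\Phi\times\mathbb Z$ put $\lambda(x)=\langle\alpha,x\rangle-n$ and $s_\lambda(x)=x-\lambda(x)\alpha^\vee$; identify $\alpha\in\Phi$ with $(\alpha,0)$; write $(\alpha,n)\perp(\beta,m)$ if $\langle\alpha,\beta\rangle=0$. Let $(\mathcal W,\phi^+,\delta,F)$ be one of the following. (Finite case) $\mathcal W=W$ is generated by the $s_\alpha$, $\alpha\in\Phi$; $\phi^+=\Phi^+$; $\delta=\Delta$; $F=\{x\in V:\langle\alpha,x\rangle>0\ \forall\alpha\in\Delta\}$ is the fundamental chamber. (Affine case) $\mathcal W=W_a$ is generated by the $s_{(\alpha,n)}$, $\alpha\in\Phi^+$, $n\in\mathbb Z$; $\phi^+=\{(\alpha,n)\in\Phi_a:(n=0\text{ and }\alpha\in\Phi^+)\text{ or }n\le-1\}$; $\delta=\{(\alpha,0):\alpha\in\Delta\}\cup\{(-\widetilde\alpha,-1)\}$;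 $F=\{x\in V:0<\langle x,\alpha\rangle<1\ \forall\alpha\in\Phi^+\}$ is the fundamental alcove. An element $w\in\mathcal W$ with linear part $w_0$ and translation part $l=w(0)$ acts on affine roots by $w(\alpha,n)=(w_0\alpha,\,n+\langle w_0\alpha,l\rangle)$ and has sign $\varepsilon(w)=\det w_0$. For $I\subset\phi^+$ let $\mathcal W^I=\{w\in\mathcal W:wI\subset\phi^+\}$ and $\mathcal I=\{wI:w\in\mathcal W^I\}$. Call $I$ consistent if (C1) there is a set $J\subset\delta\cap I$ of pairwise orthogonal elements such that the only $A\in\mathcal I$ with $J\subset A$ is $A=I$; (C2) $\varepsilon(w)=1$ for every $w\in\mathcal W$ with $wI=I$; (C3) $\mathcal I$ is finite. For consistent $I$ and $A\in\mathcal I$ let $\varepsilon_A=\varepsilon(w)$ for any $w\in\mathcal W^I$ with $wI=A$; this is well defined by (C2). Let $X=(X_t)_{t\ge0}$ be a $V$-valued process with laws $\mathbb P_x$, $x\in V$ ($\mathbb P_x$ being the law of $X$ started at $x$), which is reflectable: it has the strong Markov property, its sample paths are $\mathbb P_x$-almost surely continuous for every $x\in V$, and for all $w\in\mathcal W$ and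 $x\in V$ the law of $wX$ under $\mathbb P_x$ is the law of $X$ under $\mathbb P_{wx}$. For $\lambda\in\phi^+$ let $T_\lambda=\inf\{t\ge0:\lambda(X_t)=0\}$ (with $\inf\emptyset=\infty$), and for $A\subset\phi^+$ let $T_A=\inf_{\lambda\in A}T_\lambda$. Theorem. If $I\subset\phi^+$ is consistent, $X$ is reflectable and $x\in F$, then for every $t\ge0$ $$\mathbb P_x(T_\delta>t)=\sum_{A\in\mathcal I}\varepsilon_A\,\mathbb P_x(T_A>t).$$ -/

import Mathlib

open MeasureTheory ProbabilityTheory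
open scoped NNReal ENNReal RealInnerProductSpace

noncomputable section

namespace WeylExit

/-! ### Root systems -/

section Roots

variable {V : Type*} [NormedAddCommGroup V] [InnerProductSpace ℝ V]

/-- The coroot `α^∨ = 2α/⟪α,α⟫`. -/
def coroot (α : V) : V := (2 / ⟪α, α⟫) • α

/-- `Φ` is an irreducible (reduced) crystallographic root system in the Euclidean space `V`.
As usual for reflection groups, `Φ` need not span `V`. -/
structure IsIrreducibleRootSystem (Φ : Set V) : Prop where
  finite : Φ.Finite
  nonempty : Φ.Nonempty
  zero_notMem : (0 : V) ∉ Φ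
  reduced : ∀ α ∈ Φ, ∀ c : ℝ, c • α ∈ Φ → c = 1 ∨ c = -1
  reflection_mem : ∀ α ∈ Φ, ∀ β ∈ Φ, β - ⟪α, β⟫ • coroot α ∈ Φ
  crystallographic : ∀ α ∈ Φ, ∀ β ∈ Φ, ∃ n : ℤ, ⟪coroot α, β⟫ = n
  irreducible : ∀ Ψ ⊆ Φ, Ψ.Nonempty → (∀ α ∈ Ψ, ∀ β ∈ Φ \ Ψ, ⟪α, β⟫ = 0) → Ψ = Φ

/-- The convex cone of linear combinations of `Δ` with nonnegative coefficients. -/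
def cone (Δ : Set V) : Set V := (Submodule.span ℝ≥0 Δ : Set V)

/-- `Δ` is a simple system in `Φ`: a linearly independent subset of `Φ` such that every root is a
linear combination of `Δ` with coefficients all of the same sign. -/
structure IsSimpleSystem (Φ Δ : Set V) : Prop where
  subset : Δ ⊆ Φ
  linearIndepOn : LinearIndepOn ℝ id Δ
  same_sign : ∀ β ∈ Φ, β ∈ cone Δ ∨ -β ∈ cone Δ

/-- The positive system `Φ⁺` corresponding to `Δ`. -/
def positiveRoots (Φ Δ : Set V) : Set V := Φ ∩ cone Δ

/-- `α` is the highest root: `α - β` is a nonnegative combination of `Δ` for every root `β`. -/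
def IsHighestRoot (Φ Δ : Set V) (α : V) : Prop := α ∈ Φ ∧ ∀ β ∈ Φ, α - β ∈ cone Δ

/-! ### Affine roots

An affine root `(α, n)`, `α ∈ Φ`, `n ∈ ℤ`, is stored as an element of `V × ℝ` whose second
coordinate is the real number `n`; a root `α ∈ Φ` is identified with `(α, 0)`. -/

/-- `λ(x) = ⟪α, x⟫ - n` for `λ = (α, n)`. -/
def value (l : V × ℝ) (x : V) : ℝ := ⟪l.1, x⟫ - l.2

/-- `λ ⊥ μ`: orthogonality of the vector parts. -/
def Perp (l m : V × ℝ) : Prop := ⟪l.1, m.1⟫ = 0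

/-- The affine reflection `s_λ = τ(n α^∨) s_α` for `λ = (α, n)`. -/
def affineReflection (l : V × ℝ) : V ≃ᵃⁱ[ℝ] V :=
  AffineIsometryEquiv.constVAdd ℝ V (l.2 • coroot l.1) *
    ((ℝ ∙ l.1)ᗮ.reflection).toAffineIsometryEquiv

theorem affineReflection_apply (l : V × ℝ) (x : V) :
    affineReflection l x = x - value l x • coroot l.1 := by
  have h : ((ℝ ∙ l.1)ᗮ.reflection) x = x - ⟪l.1, x⟫ • coroot l.1 := by
    rw [Submodule.reflection_orthogonal_apply, Submodule.reflection_singleton_apply]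
    simp only [coroot, smul_smul, real_inner_self_eq_norm_sq]
    simp only [RCLike.ofReal_real_eq_id, id_eq, two_smul, neg_sub]
    rw [← add_smul]
    congr 2
    ring
  simp only [affineReflection, AffineIsometryEquiv.coe_mul, Function.comp_apply,
    LinearIsometryEquiv.coe_toAffineIsometryEquiv, AffineIsometryEquiv.coe_constVAdd, h, value,
    vadd_eq_add, sub_smul]
  abel

/-- The action `w(α, n) = (w₀ α, n + ⟪w₀ α, l⟫)` of `w = τ(l) w₀`, where `w₀` is the linear part of
`w` and `l = w 0`. -/
def act (w : V ≃ᵃⁱ[ℝ] V) (l : V × ℝ) : V × ℝ :=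
  (w.linearIsometryEquiv l.1, l.2 + ⟪w.linearIsometryEquiv l.1, w 0⟫)

/-- The sign `ε(w) = det w₀`, where `w₀` is the linear part of `w`. -/
def sign (w : V ≃ᵃⁱ[ℝ] V) : ℝ := LinearMap.det (w.linearIsometryEquiv.toLinearEquiv : V →ₗ[ℝ] V)

theorem act_one (l : V × ℝ) : act (1 : V ≃ᵃⁱ[ℝ] V) l = l := by
  have h : (1 : V ≃ᵃⁱ[ℝ] V).linearIsometryEquiv l.1 = l.1 := by
    simpa using (1 : V ≃ᵃⁱ[ℝ] V).map_vsub l.1 0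
  ext <;> simp [act, h]

theorem act_mul (u w : V ≃ᵃⁱ[ℝ] V) (l : V × ℝ) : act (u * w) l = act u (act w l) := by
  have h (v : V ≃ᵃⁱ[ℝ] V) (x : V) : v.linearIsometryEquiv x = v x - v 0 := by
    simpa using v.map_vsub x 0
  have e : (u * w).linearIsometryEquiv l.1 =
      u.linearIsometryEquiv (w.linearIsometryEquiv l.1) := by
    rw [h w, map_sub]; simp [h]
  have e0 : (u * w) 0 = u.linearIsometryEquiv (w 0) + u 0 := by simp [h]
  simp only [act, e, e0, inner_add_right, LinearIsometryEquiv.inner_map_map, add_assoc]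

theorem sign_mul (u w : V ≃ᵃⁱ[ℝ] V) : sign (u * w) = sign u * sign w := by
  rw [sign, sign, sign, ← LinearMap.det_comp]
  congr 1

/-! ### The finite and the affine setting -/

/-- A reflection group together with its positive roots, simple roots and fundamental region. -/
structure Setting (V : Type*) [NormedAddCommGroup V] [InnerProductSpace ℝ V] where
  /-- the reflection group -/
  group : Subgroup (V ≃ᵃⁱ[ℝ] V)
  /-- the positive (affine) roots -/
  pos : Set (V × ℝ)
  /-- the simple (affine) roots -/
  simple : Set (V × ℝ)
  /-- the fundamental chamber or alcove -/
  region : Set V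

/-- The finite Weyl group `W`, with `Φ⁺`, `Δ` and the fundamental chamber. -/
def finiteSetting (Φ Δ : Set V) : Setting V where
  group := Subgroup.closure {w | ∃ α ∈ Φ, w = affineReflection (α, 0)}
  pos := {l | l.1 ∈ positiveRoots Φ Δ ∧ l.2 = 0}
  simple := {l | l.1 ∈ Δ ∧ l.2 = 0}
  region := {x | ∀ α ∈ Δ, 0 < ⟪α, x⟫}

/-- The affine Weyl group `W_a`, with `Φ_a⁺`, `Δ_a` and the fundamental alcove; `θ` is the highest
root. -/
def affineSetting (Φ Δ : Set V) (θ : V) : Setting V where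
  group := Subgroup.closure {w | ∃ α ∈ positiveRoots Φ Δ, ∃ n : ℤ, w = affineReflection (α, (n : ℝ))}
  pos := {l | (l.1 ∈ positiveRoots Φ Δ ∧ l.2 = 0) ∨ (l.1 ∈ Φ ∧ ∃ n : ℤ, n ≤ -1 ∧ l.2 = (n : ℝ))}
  simple := {l | (l.1 ∈ Δ ∧ l.2 = 0) ∨ l = (-θ, -1)}
  region := {x | ∀ α ∈ positiveRoots Φ Δ, 0 < ⟪x, α⟫ ∧ ⟪x, α⟫ < 1}

/-! ### Consistency -/

namespace Setting

/-- `𝒲^I`: the elements `w` of the group with `w I ⊆ φ⁺`. -/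
def keep (D : Setting V) (I : Set (V × ℝ)) : Set (V ≃ᵃⁱ[ℝ] V) :=
  {w | w ∈ D.group ∧ act w '' I ⊆ D.pos}

/-- `𝓘 = {w I : w ∈ 𝒲^I}`. -/
def orbit (D : Setting V) (I : Set (V × ℝ)) : Set (Set (V × ℝ)) :=
  {A | ∃ w ∈ D.keep I, act w '' I = A}

/-- The conditions (C1), (C2), (C3) on `I`. -/
structure IsConsistent (D : Setting V) (I : Set (V × ℝ)) : Prop where
  c1 : ∃ J ⊆ D.simple ∩ I, J.Pairwise Perp ∧ ∀ A ∈ D.orbit I, J ⊆ A → A = I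
  c2 : ∀ w ∈ D.group, act w '' I = I → sign w = 1
  c3 : (D.orbit I).Finite

/-- The sign `ε_A = ε(w)`, where `w` is any element of `𝒲^I` with `w I = A`. -/
def orbitSign (D : Setting V) (I A : Set (V × ℝ)) : ℝ :=
  sign (Classical.epsilon fun w => w ∈ D.keep I ∧ act w '' I = A)

/-- Under (C2), `ε_A` does not depend on the choice of `w`. -/
theorem orbitSign_eq (D : Setting V) (I : Set (V × ℝ))
    (h2 : ∀ w ∈ D.group, act w '' I = I → sign w = 1) (w : V ≃ᵃⁱ[ℝ] V) (hw : w ∈ D.keep I) :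
    D.orbitSign I (act w '' I) = sign w := by
  obtain ⟨hu, hA⟩ := Classical.epsilon_spec
    (p := fun u => u ∈ D.keep I ∧ act u '' I = act w '' I) ⟨w, hw, rfl⟩
  rw [orbitSign]
  generalize (Classical.epsilon fun u => u ∈ D.keep I ∧ act u '' I = act w '' I) = u at hu hA ⊢
  have h := h2 (w⁻¹ * u) (D.group.mul_mem (D.group.inv_mem hw.1) hu.1) (by
    have e : act (w⁻¹ * u) = act w⁻¹ ∘ act u := funext (act_mul _ _)
    have e' : act w⁻¹ ∘ act w = id := by
      rw [show act w⁻¹ ∘ act w = act (w⁻¹ * w) from funext fun l => (act_mul _ _ l).symm]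
      simp [funext_iff, act_one]
    rw [e, Set.image_comp, hA, ← Set.image_comp, e', Set.image_id])
  calc sign u = sign (w * (w⁻¹ * u)) := by rw [mul_inv_cancel_left]
    _ = sign w := by rw [sign_mul, h, mul_one]

end Setting

end Roots

/-! ### Processes -/

section Processes

variable {V : Type*} [NormedAddCommGroup V] [InnerProductSpace ℝ V] [FiniteDimensional ℝ V]
  [MeasurableSpace V] [BorelSpace V] {Ω : Type*} [MeasurableSpace Ω]

/-- The trajectory of `X` at `ω`; path space `ℝ≥0 → V` carries the product `σ`-algebra. -/
def path (X : ℝ≥0 → Ω → V) (ω : Ω) : ℝ≥0 → V := fun t => X t ω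

/-- The strong Markov property of the family `(P_x)` of laws on `Ω`: for every stopping time `τ` of
the natural filtration of `X`, conditionally on `ℱ_τ` and on `τ < ∞`, the process
`(X_{τ+s})_{s ≥ 0}` has the law of `X` under `P_y` with `y = X_τ`. -/
def StrongMarkov (P : Kernel V Ω) (X : ℝ≥0 → Ω → V) (hX : ∀ t, Measurable (X t)) : Prop :=
  ∀ (τ : Ω → WithTop ℝ≥0)
    (hτ : IsStoppingTime (Filtration.natural X fun t => (hX t).stronglyMeasurable) τ)
    (B : Set Ω), MeasurableSet[hτ.measurableSpace] B → (∀ ω ∈ B, τ ω ≠ ⊤) →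
    ∀ G : Set (ℝ≥0 → V), MeasurableSet G → ∀ x : V,
      P x (B ∩ {ω | (fun s => X ((τ ω).untopA + s) ω) ∈ G}) =
        ∫⁻ ω in B, P (X (τ ω).untopA ω) {ω' | path X ω' ∈ G} ∂(P x)

/-- `X`, with `P_x` the law started at `x`, is a reflectable process for the group `W`. -/
structure IsReflectable (W : Subgroup (V ≃ᵃⁱ[ℝ] V)) (P : Kernel V Ω) (X : ℝ≥0 → Ω → V) :
    Prop where
  measurable : ∀ t, Measurable (X t)
  start : ∀ x, ∀ᵐ ω ∂(P x), X 0 ω = x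
  strongMarkov : StrongMarkov P X measurable
  continuous : ∀ x, ∀ᵐ ω ∂(P x), Continuous (path X ω)
  invariant : ∀ w ∈ W, ∀ x,
    (P x).map (fun ω t => w (X t ω)) = (P (w x)).map (path X)

/-- `T_λ = inf {t ≥ 0 : λ(X_t) = 0}`, with `inf ∅ = ∞`. -/
def hitTime (X : ℝ≥0 → Ω → V) (l : V × ℝ) (ω : Ω) : ℝ≥0∞ :=
  ⨅ (t : ℝ≥0) (_ : value l (X t ω) = 0), (t : ℝ≥0∞)

/-- `T_A = min_{λ ∈ A} T_λ`. -/
def exitTime (X : ℝ≥0 → Ω → V) (A : Set (V × ℝ)) (ω : Ω) : ℝ≥0∞ :=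
  ⨅ l ∈ A, hitTime X l ω

end Processes

end WeylExit

end

/-! Exit probabilities from a Weyl chamber or alcove by a reflection argument.

Up to the exit time `T_δ` from the fundamental region every positive root is positive on the path,
so `T_A ≥ T_δ` for every `A ∈ 𝓘`, and `{T_A > t}` is, up to a null set, the disjoint union of
`{T_δ > t}` and, over the simple roots `l`, of the events `M l A` that the path leaves through the
wall of `l` by time `t` but meets no hyperplane of `A` up to time `t`. The theorem thus reduces to
`∑_A ε_A = 1` and `∑_A ε_A P_x(M l A) = 0` for each `l`. Both come from the involution `A ↦ s_l A`
on the members of `𝓘` that do not contain `l`: it stays inside `𝓘` because `s_l` permutes the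
positive roots other than `l`, and it reverses the sign.

* For `∑_A ε_A = 1` (`sum_orbitSign`), the elements of the orthogonal set `J` of (C1) are treated
  one after the other. Since `s_l` fixes the elements of `J` other than `l`, the sets missing `l`
  cancel among those that contain the elements treated before, and in the end only `I` is left.
* If `l ∈ A`, then `M l A` is null. If `l ∉ A`, then `M l A` and `M l (s_l A)` have the same
  probability by the reflection principle (`IsReflectable.measure_inter_reflect`): at the exit
  time the process is on the wall of `l`, where the law of the process is invariant under `s_l`,
  so by the strong Markov property the later path may be reflected.

That `s_l` permutes the positive roots other than `l` is classical for a simple root of `Φ`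
(`sub_smul_mem_positiveRoots`). For the affine simple root `(-θ, -1)` it rests on `|⟪θ^∨, β⟫| ≤ 1`
for all roots `β ≠ ±θ`, which follows from the maximality of `θ` alone.

The measure theory needs care because paths are continuous only almost surely and the strong
Markov property is available only for stopping times of the raw natural filtration. Hitting times
are therefore replaced by almost surely equal ones: by a genuine stopping time
(`exists_isStoppingTime_first_zero`) where the strong Markov property is used, and by a measurable
functional on path space (`regularExitTime`) where joint laws are compared. -/

noncomputable section

namespace WeylExit

/-! ### Affine reflections and their action on affine roots -/

section Reflections

variable {V : Type*} [NormedAddCommGroup V] [InnerProductSpace ℝ V]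

theorem inner_coroot_self {α : V} (hα : α ≠ 0) : ⟪coroot α, α⟫ = 2 := by
  rw [coroot, inner_smul_left]
  exact div_mul_cancel₀ 2 (inner_self_ne_zero.2 hα)

theorem inner_smul_coroot (α β : V) : ⟪α, β⟫ • coroot α = ⟪coroot α, β⟫ • α := by
  simp only [coroot, smul_smul, inner_smul_left]
  congr 1
  simp
  ring

/-- In `V × ℝ` the reflection `s_λ` acts on affine roots by the linear reflection formula, with the
translation part absorbed in the second coordinate. -/
theorem act_affineReflection {l : V × ℝ} (hl : l.1 ≠ 0) (m : V × ℝ) :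
    act (affineReflection l) m = m - ⟪coroot l.1, m.1⟫ • l := by
  have h0 : affineReflection l 0 = l.2 • coroot l.1 := by
    simp [affineReflection_apply, value]
  have h1 : (affineReflection l).linearIsometryEquiv m.1 = m.1 - ⟪coroot l.1, m.1⟫ • l.1 := by
    have : (affineReflection l).linearIsometryEquiv m.1 =
        affineReflection l m.1 - affineReflection l 0 := by
      simpa using (affineReflection l).map_vsub m.1 0
    rw [this, h0, affineReflection_apply, value, sub_smul, inner_smul_coroot]
    abel
  have h2 : ⟪m.1 - ⟪coroot l.1, m.1⟫ • l.1, l.2 • coroot l.1⟫ = -(⟪coroot l.1, m.1⟫ * l.2) := by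
    rw [inner_sub_left, inner_smul_left, inner_smul_right, inner_smul_right,
      real_inner_comm (coroot l.1) l.1, inner_coroot_self hl, real_inner_comm]
    simp
    ring
  ext
  · simp [act, h1]
  · simp [act, h1, h0, h2]
    ring

theorem act_affineReflection_self {l : V × ℝ} (hl : l.1 ≠ 0) :
    act (affineReflection l) l = -l := by
  rw [act_affineReflection hl, inner_coroot_self hl, two_smul]
  abel

theorem act_affineReflection_of_perp {l m : V × ℝ} (hl : l.1 ≠ 0) (h : Perp l m) :
    act (affineReflection l) m = m := by
  rw [act_affineReflection hl, coroot, inner_smul_left, show ⟪l.1, m.1⟫ = 0 from h]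
  simp

theorem affineReflection_mul_self (l : V × ℝ) : affineReflection l * affineReflection l = 1 := by
  ext x
  by_cases hl : l.1 = 0
  · simp [affineReflection_apply, hl, coroot]
  · have h : value l (x - value l x • coroot l.1) = - value l x := by
      rw [value, inner_sub_right, inner_smul_right, real_inner_comm (coroot l.1) l.1,
        inner_coroot_self hl, value]
      ring
    rw [AffineIsometryEquiv.coe_mul, Function.comp_apply, affineReflection_apply,
      affineReflection_apply, h]
    simp

theorem act_affineReflection_involutive (l : V × ℝ) :
    Function.Involutive (act (affineReflection l)) := fun m => by
  rw [← act_mul, affineReflection_mul_self, act_one]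

theorem affineReflection_neg (l : V × ℝ) : affineReflection (-l) = affineReflection l := by
  ext x
  simp only [affineReflection_apply, value, coroot, Prod.fst_neg, Prod.snd_neg, inner_neg_left,
    inner_neg_right, neg_neg, smul_neg, ← neg_smul]
  module

theorem value_act (w : V ≃ᵃⁱ[ℝ] V) (l : V × ℝ) (x : V) : value (act w l) (w x) = value l x := by
  have h : w x = w.linearIsometryEquiv x + w 0 := by
    have : w.linearIsometryEquiv x = w x - w 0 := by simpa using w.map_vsub x 0
    rw [this, sub_add_cancel]
  rw [value, h, act, inner_add_right, LinearIsometryEquiv.inner_map_map, value]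
  ring

theorem value_affineReflection (l m : V × ℝ) (x : V) :
    value m (affineReflection l x) = value (act (affineReflection l) m) x := by
  rw [← value_act (affineReflection l) (act (affineReflection l) m) x,
    act_affineReflection_involutive]

theorem affineReflection_of_value_eq_zero {l : V × ℝ} {x : V} (h : value l x = 0) :
    affineReflection l x = x := by
  rw [affineReflection_apply, h, zero_smul, sub_zero]

theorem sign_affineReflection [FiniteDimensional ℝ V] {l : V × ℝ} (hl : l.1 ≠ 0) :
    sign (affineReflection l) = -1 := by
  have h : (affineReflection l).linearIsometryEquiv = (ℝ ∙ l.1)ᗮ.reflection := by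
    ext x
    have : (affineReflection l).linearIsometryEquiv x =
        affineReflection l x - affineReflection l 0 := by
      simpa using (affineReflection l).map_vsub x 0
    rw [this]
    simp [affineReflection]
  have := Submodule.det_reflection (ℝ ∙ l.1)ᗮ
  rw [Submodule.orthogonal_orthogonal, finrank_span_singleton hl, pow_one] at this
  rw [sign, h, ← this]

@[fun_prop]
theorem continuous_value (l : V × ℝ) : Continuous (value l) := by
  unfold value
  fun_prop

end Reflections

/-! ### Cones and root systems -/

section RootSystems

variable {V : Type*} [NormedAddCommGroup V] [InnerProductSpace ℝ V] {Φ Δ : Set V}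

theorem smul_mem_cone {c : ℝ} (hc : 0 ≤ c) {v : V} (hv : v ∈ cone Δ) : c • v ∈ cone Δ :=
  (Submodule.span ℝ≥0 Δ).smul_mem (⟨c, hc⟩ : ℝ≥0) hv

theorem add_mem_cone {v w : V} (hv : v ∈ cone Δ) (hw : w ∈ cone Δ) : v + w ∈ cone Δ :=
  (Submodule.span ℝ≥0 Δ).add_mem hv hw

theorem subset_cone : Δ ⊆ cone Δ := Submodule.subset_span

/-- A linear function that is positive on `Δ` is nonnegative on the cone and vanishes there only at
`0`; linearity is spelt out so that it applies to functionals and to `⟪·, x⟫` alike. -/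
theorem nonneg_and_eq_zero_of_mem_cone {f : V → ℝ} (hadd : ∀ v w, f (v + w) = f v + f w)
    (hsmul : ∀ (c : ℝ) v, f (c • v) = c * f v) (hf : ∀ γ ∈ Δ, 0 < f γ) {v : V} (hv : v ∈ cone Δ) :
    0 ≤ f v ∧ (f v = 0 → v = 0) := by
  have h0 : f 0 = 0 := by simpa using hsmul 0 0
  induction hv using Submodule.span_induction with
  | mem γ hγ => exact ⟨(hf γ hγ).le, fun h => absurd h (hf γ hγ).ne'⟩
  | zero => simp [h0]
  | add v w _ _ hv hw =>
    rw [hadd]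
    refine ⟨add_nonneg hv.1 hw.1, fun h => ?_⟩
    rw [hv.2 (by linarith [hv.1, hw.1]), hw.2 (by linarith [hv.1, hw.1]), add_zero]
  | smul c v _ hv =>
    have hc : f (c • v) = (c : ℝ) * f v := hsmul c v
    rw [hc]
    refine ⟨mul_nonneg c.2 hv.1, fun h => ?_⟩
    rcases mul_eq_zero.1 h with h | h
    · rw [NNReal.coe_eq_zero.1 h, zero_smul]
    · rw [hv.2 h, smul_zero]

/-- A point at which all simple roots are positive makes every nonzero element of the cone
positive. -/
theorem inner_pos_of_mem_cone {x : V} (hx : ∀ γ ∈ Δ, 0 < ⟪γ, x⟫) {v : V} (hv : v ∈ cone Δ)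
    (hv0 : v ≠ 0) : 0 < ⟪v, x⟫ := by
  obtain ⟨h1, h2⟩ := nonneg_and_eq_zero_of_mem_cone (f := fun v => ⟪v, x⟫)
    (fun v w => inner_add_left v w x) (fun c v => real_inner_smul_left v x c) hx hv
  exact h1.lt_of_ne fun h => hv0 (h2 h.symm)

theorem inner_nonneg_of_mem_cone {x : V} (hx : ∀ γ ∈ Δ, 0 < ⟪γ, x⟫) {v : V} (hv : v ∈ cone Δ) :
    0 ≤ ⟪v, x⟫ := by
  by_cases h : v = 0
  · simp [h]
  · exact (inner_pos_of_mem_cone hx hv h).le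

theorem exists_functional (hΔ : LinearIndepOn ℝ id Δ) (g : V → ℝ) :
    ∃ f : V →ₗ[ℝ] ℝ, ∀ γ ∈ Δ, f γ = g γ := by
  obtain ⟨f, hf⟩ := LinearMap.exists_extend
    ((Module.Basis.span (LinearIndepOn.linearIndependent hΔ)).constr ℝ fun γ : Δ => g γ)
  refine ⟨f, fun γ hγ => ?_⟩
  have hb : ((Module.Basis.span (LinearIndepOn.linearIndependent hΔ)) ⟨γ, hγ⟩ : V) = γ := by
    rw [Module.Basis.span_apply]
    rfl
  have := LinearMap.congr_fun hf (Module.Basis.span (LinearIndepOn.linearIndependent hΔ) ⟨γ, hγ⟩)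
  rw [Module.Basis.constr_basis] at this
  simpa [hb] using this

/-- The cone of a linearly independent set is pointed. -/
theorem eq_zero_of_mem_cone_of_neg_mem_cone (hΔ : LinearIndepOn ℝ id Δ) {v : V} (h : v ∈ cone Δ)
    (h' : -v ∈ cone Δ) : v = 0 := by
  obtain ⟨f, hf⟩ := exists_functional hΔ fun _ => 1
  have key {w : V} (hw : w ∈ cone Δ) := nonneg_and_eq_zero_of_mem_cone (f := f) (map_add f)
    (fun c v => by simp) (fun γ hγ => by simp [hf γ hγ]) hw
  have h2 := (key h').1
  rw [map_neg] at h2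
  exact (key h).2 (by linarith [(key h).1])

namespace IsIrreducibleRootSystem

theorem ne_zero (hΦ : IsIrreducibleRootSystem Φ) {α : V} (hα : α ∈ Φ) : α ≠ 0 :=
  fun h => hΦ.zero_notMem (h ▸ hα)

theorem sub_smul_mem (hΦ : IsIrreducibleRootSystem Φ) {α β : V} (hα : α ∈ Φ) (hβ : β ∈ Φ) :
    β - ⟪coroot α, β⟫ • α ∈ Φ := by
  rw [← inner_smul_coroot]
  exact hΦ.reflection_mem α hα β hβ

theorem neg_mem (hΦ : IsIrreducibleRootSystem Φ) {α : V} (hα : α ∈ Φ) : -α ∈ Φ := by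
  have := hΦ.sub_smul_mem hα hα
  rwa [inner_coroot_self (hΦ.ne_zero hα), two_smul, sub_add_cancel_left] at this

end IsIrreducibleRootSystem

/-- A simple reflection `s_α` permutes the positive roots other than `α`: such a root has a positive
coefficient at another simple root, and `s_α` does not change that coefficient. -/
theorem sub_smul_mem_positiveRoots (hΦ : IsIrreducibleRootSystem Φ) (hΔ : IsSimpleSystem Φ Δ)
    {α β : V} (hα : α ∈ Δ) (hβ : β ∈ positiveRoots Φ Δ) (hne : β ≠ α) :
    β - ⟪coroot α, β⟫ • α ∈ positiveRoots Φ Δ := by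
  classical
  -- the sum of the coefficients at the simple roots other than `α`
  obtain ⟨f, hf⟩ := exists_functional hΔ.linearIndepOn fun γ => if γ = α then 0 else 1
  have hfα : f α = 0 := by simp [hf α hα]
  have split {v : V} (hv : v ∈ cone Δ) : 0 ≤ f v ∧ (f v = 0 → ∃ c : ℝ, 0 ≤ c ∧ v = c • α) := by
    rw [← Set.insert_sdiff_self_of_mem hα] at hv
    obtain ⟨c, z, hz, rfl⟩ := Submodule.mem_span_insert.1 hv
    have := nonneg_and_eq_zero_of_mem_cone (f := f) (map_add f) (fun c v => by simp)
      (fun γ hγ => by simp [hf γ hγ.1, show γ ≠ α from hγ.2]) hz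
    have e : f (c • α + z) = f z := by
      have : f (c • α) = (c : ℝ) * f α := by
        change f ((c : ℝ) • α) = _
        simp
      rw [map_add, this, hfα]
      simp
    rw [e]
    exact ⟨this.1, fun h => ⟨c, c.2, by rw [this.2 h, add_zero]; rfl⟩⟩
  have hpos : 0 < f β := by
    refine (split hβ.2).1.lt_of_ne fun h => ?_
    obtain ⟨c, hc, rfl⟩ := (split hβ.2).2 h.symm
    rcases hΦ.reduced α (hΔ.subset hα) c hβ.1 with rfl | rfl
    · exact hne (one_smul _ _)
    · linarith
  have hmem := hΦ.sub_smul_mem (hΔ.subset hα) hβ.1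
  refine ⟨hmem, (hΔ.same_sign _ hmem).resolve_right fun h => ?_⟩
  have := (split h).1
  simp only [map_neg, map_sub, map_smul, hfα, smul_zero, sub_zero] at this
  linarith

theorem IsHighestRoot.mem_cone (hΦ : IsIrreducibleRootSystem Φ)
    {θ : V} (hθ : IsHighestRoot Φ Δ θ) : θ ∈ cone Δ := by
  have h2 : θ - -θ ∈ cone Δ := hθ.2 _ (hΦ.neg_mem hθ.1)
  have := smul_mem_cone (c := 1 / 2) (by norm_num) h2
  rwa [sub_neg_eq_add, ← two_smul ℝ, smul_smul, show (1 / 2 * 2 : ℝ) = 1 by norm_num,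
    one_smul] at this

/-- For the highest root `θ` and a root `β ≠ θ`, the integer `⟪θ^∨, β⟫` is at most `1`. With
`k = ⟪θ^∨, β⟫` the root `-s_θ β = kθ - β` lies below `θ`, so `β - (k - 1)θ` is in the cone, as is
`θ - β`; if `k ≥ 2` this forces `k = 2` and `β = θ`. -/
theorem IsHighestRoot.inner_coroot_le_one (hΦ : IsIrreducibleRootSystem Φ)
    (hΔ : IsSimpleSystem Φ Δ) {θ : V} (hθ : IsHighestRoot Φ Δ θ) {β : V} (hβ : β ∈ Φ)
    (hne : β ≠ θ) {k : ℤ} (hk : ⟪coroot θ, β⟫ = k) : k ≤ 1 := by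
  by_contra! h
  have hk2 : (2 : ℝ) ≤ k := by exact_mod_cast h
  have hθc := IsHighestRoot.mem_cone hΦ hθ
  have h1 := hθ.2 _ (hΦ.neg_mem (hΦ.sub_smul_mem hθ.1 hβ))
  rw [hk] at h1
  have h2 := smul_mem_cone (c := (k : ℝ) - 2) (by linarith) hθc
  refine hne (sub_eq_zero.1 (eq_zero_of_mem_cone_of_neg_mem_cone hΔ.linearIndepOn
    (v := β - θ) ?_ (by simpa using hθ.2 β hβ)))
  have := add_mem_cone h1 h2
  have e : θ - -(β - (k : ℝ) • θ) + ((k : ℝ) - 2) • θ = β - θ := by module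
  rwa [e] at this

theorem IsHighestRoot.neg_one_le_inner_coroot (hΦ : IsIrreducibleRootSystem Φ)
    (hΔ : IsSimpleSystem Φ Δ) {θ : V} (hθ : IsHighestRoot Φ Δ θ) {β : V} (hβ : β ∈ Φ)
    (hne : β ≠ -θ) {k : ℤ} (hk : ⟪coroot θ, β⟫ = k) : -1 ≤ k := by
  have := IsHighestRoot.inner_coroot_le_one hΦ hΔ hθ (hΦ.neg_mem hβ)
    (fun h => hne (by rw [← h, neg_neg])) (k := -k) (by rw [inner_neg_right, hk]; simp)
  omega

theorem neg_notMem_cone (hΦ : IsIrreducibleRootSystem Φ) (hΔ : IsSimpleSystem Φ Δ) {β : V}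
    (hβ : β ∈ positiveRoots Φ Δ) : -β ∉ cone Δ := fun h =>
  hΦ.ne_zero hβ.1 (eq_zero_of_mem_cone_of_neg_mem_cone hΔ.linearIndepOn hβ.2 h)

end RootSystems

/-! ### The finite and the affine reflection system -/

/-- What the reflection argument uses of a reflection group with positive roots and simple roots:
each simple reflection permutes the positive roots other than the simple one, and the positive roots
are positive wherever the simple ones are. -/
structure Setting.IsReflectionSystem {V : Type*} [NormedAddCommGroup V] [InnerProductSpace ℝ V]
    (D : Setting V) : Prop where
  finite_simple : D.simple.Finite
  countable_pos : D.pos.Countable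
  simple_subset : D.simple ⊆ D.pos
  fst_ne_zero : ∀ l ∈ D.simple, l.1 ≠ 0
  reflection_mem : ∀ l ∈ D.simple, affineReflection l ∈ D.group
  neg_notMem : ∀ l ∈ D.pos, -l ∉ D.pos
  act_mem : ∀ l ∈ D.simple, ∀ m ∈ D.pos, m ≠ l → act (affineReflection l) m ∈ D.pos
  value_pos : ∀ x, (∀ l ∈ D.simple, 0 < value l x) → ∀ m ∈ D.pos, 0 < value m x

section RootSystems

variable {V : Type*} [NormedAddCommGroup V] [InnerProductSpace ℝ V] {Φ Δ : Set V}

theorem isReflectionSystem_finiteSetting (hΦ : IsIrreducibleRootSystem Φ)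
    (hΔ : IsSimpleSystem Φ Δ) : (finiteSetting Φ Δ).IsReflectionSystem where
  finite_simple := by
    have : (finiteSetting Φ Δ).simple = Δ ×ˢ {0} := by
      ext l
      simp [finiteSetting]
    rw [this]
    exact (hΦ.finite.subset hΔ.subset).prod (Set.finite_singleton 0)
  countable_pos := ((hΦ.finite.prod (Set.finite_singleton (0 : ℝ))).subset
    fun l hl => ⟨hl.1.1, hl.2⟩).countable
  simple_subset l hl := ⟨⟨hΔ.subset hl.1, subset_cone hl.1⟩, hl.2⟩
  fst_ne_zero l hl := hΦ.ne_zero (hΔ.subset hl.1)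
  reflection_mem l hl := Subgroup.subset_closure
    ⟨l.1, hΔ.subset hl.1, by rw [show l = (l.1, 0) from Prod.ext rfl hl.2]⟩
  neg_notMem l hl h := neg_notMem_cone hΦ hΔ hl.1 h.1.2
  act_mem l hl m hm hne := by
    rw [act_affineReflection (hΦ.ne_zero (hΔ.subset hl.1))]
    refine ⟨sub_smul_mem_positiveRoots hΦ hΔ hl.1 hm.1 fun h => hne (Prod.ext h ?_), ?_⟩
    · rw [hm.2, hl.2]
    · simp [hm.2, hl.2]
  value_pos x hx m hm := by
    have := inner_pos_of_mem_cone (x := x) (fun γ hγ => by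
      simpa [value] using hx (γ, 0) ⟨hγ, rfl⟩) hm.1.2 (hΦ.ne_zero hm.1.1)
    simpa [value, hm.2] using this

theorem isReflectionSystem_affineSetting (hΦ : IsIrreducibleRootSystem Φ)
    (hΔ : IsSimpleSystem Φ Δ) {θ : V} (hθ : IsHighestRoot Φ Δ θ) :
    (affineSetting Φ Δ θ).IsReflectionSystem where
  finite_simple := by
    have : (affineSetting Φ Δ θ).simple = Δ ×ˢ {0} ∪ {(-θ, -1)} := by
      ext l
      simp [affineSetting, or_comm]
    rw [this]
    exact ((hΦ.finite.subset hΔ.subset).prod (Set.finite_singleton 0)).union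
      (Set.finite_singleton _)
  countable_pos := by
    refine (hΦ.finite.countable.prod (Set.countable_range fun n : ℤ => (n : ℝ))).mono ?_
    rintro l (hl | ⟨hl, n, -, hn⟩)
    · exact ⟨hl.1.1, 0, by simp [hl.2]⟩
    · exact ⟨hl, n, hn.symm⟩
  simple_subset := by
    rintro l (hl | rfl)
    · exact Or.inl ⟨⟨hΔ.subset hl.1, subset_cone hl.1⟩, hl.2⟩
    · exact Or.inr ⟨hΦ.neg_mem hθ.1, -1, le_rfl, by simp⟩
  fst_ne_zero := by
    rintro l (hl | rfl)
    · exact hΦ.ne_zero (hΔ.subset hl.1)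
    · exact hΦ.ne_zero (hΦ.neg_mem hθ.1)
  reflection_mem := by
    rintro l (hl | rfl)
    · exact Subgroup.subset_closure ⟨l.1, ⟨hΔ.subset hl.1, subset_cone hl.1⟩, 0,
        by rw [show l = (l.1, 0) from Prod.ext rfl hl.2]; simp⟩
    · refine Subgroup.subset_closure ⟨θ, ⟨hθ.1, IsHighestRoot.mem_cone hΦ hθ⟩, 1, ?_⟩
      rw [← affineReflection_neg]
      simp
  neg_notMem := by
    rintro l (hl | ⟨hl, n, hn, hln⟩) (h | ⟨h, k, hk, hlk⟩)
    · exact neg_notMem_cone hΦ hΔ hl.1 h.1.2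
    · rw [Prod.snd_neg, hl.2, neg_zero] at hlk
      have : k = 0 := by exact_mod_cast hlk.symm
      omega
    · have h2 := h.2
      rw [Prod.snd_neg, hln, neg_eq_zero] at h2
      have : n = 0 := by exact_mod_cast h2
      omega
    · rw [Prod.snd_neg, hln] at hlk
      have : -n = k := by exact_mod_cast hlk
      omega
  act_mem := by
    have hn0 := hΦ.ne_zero hθ.1
    rintro l (hl | rfl) m hm hne
    · rw [act_affineReflection (hΦ.ne_zero (hΔ.subset hl.1))]
      rcases hm with hm | ⟨hm, n, hn, hmn⟩
      · refine Or.inl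
          ⟨sub_smul_mem_positiveRoots hΦ hΔ hl.1 hm.1 fun h => hne (Prod.ext h ?_), ?_⟩
        · rw [hm.2, hl.2]
        · simp [hm.2, hl.2]
      · exact Or.inr ⟨hΦ.sub_smul_mem (hΔ.subset hl.1) hm, n, hn, by simp [hl.2, hmn]⟩
    · rw [show ((-θ, -1) : V × ℝ) = -(θ, 1) by simp, affineReflection_neg,
        act_affineReflection hn0]
      have hmΦ : m.1 ∈ Φ := hm.elim (fun h => h.1.1) fun h => h.1
      obtain ⟨k, hk⟩ := hΦ.crystallographic θ hθ.1 m.1 hmΦ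
      have hs := hΦ.sub_smul_mem hθ.1 hmΦ
      rw [hk] at hs
      dsimp only
      rw [hk]
      have hkneg : m.1 ≠ -θ → k < 0 → k = -1 ∧ m.1 - (k : ℝ) • θ = m.1 + θ := fun h hk0 => by
        have := IsHighestRoot.neg_one_le_inner_coroot hΦ hΔ hθ hmΦ h hk
        obtain rfl : k = -1 := by omega
        simp
      rcases hm with hm | ⟨hm, n, hn, hmn⟩
      · -- a positive root: `k ≥ 0`, and `s_θ` fixes it or lowers its level below zero
        have hk0 : 0 ≤ k := by
          by_contra! hlt
          have hne' : m.1 ≠ -θ := fun h => neg_notMem_cone hΦ hΔ hm.1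
            (by rw [h, neg_neg]; exact IsHighestRoot.mem_cone hΦ hθ)
          rw [(hkneg hne' hlt).2] at hs
          have := hθ.2 _ hs
          rw [sub_add_cancel_right] at this
          exact neg_notMem_cone hΦ hΔ hm.1 this
        rcases hk0.eq_or_lt with rfl | hk1
        · left
          simpa using hm
        · refine Or.inr ⟨hs, -k, by omega, ?_⟩
          simp [hm.2]
      · -- negative level: `n - k ≤ -1` unless `k < 0`, which means `k = -1` or `m.1 = -θ`, `k = -2`
        by_cases hmθ : m.1 = -θ
        · have hk2 : k = -2 := by
            rw [hmθ, inner_neg_right, inner_coroot_self hn0] at hk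
            exact_mod_cast hk.symm
          have hn1 : n ≠ -1 := fun h => hne (Prod.ext hmθ (by rw [hmn, h]; simp))
          have e : m.1 - (k : ℝ) • θ = θ := by
            rw [hmθ, hk2]
            push_cast
            module
          by_cases hn2 : n = -2
          · left
            refine ⟨?_, ?_⟩
            · change m.1 - (k : ℝ) • θ ∈ _
              rw [e]
              exact ⟨hθ.1, IsHighestRoot.mem_cone hΦ hθ⟩
            · simp [hmn, hn2, hk2]
          · exact Or.inr ⟨hs, n - k, by omega, by simp [hmn]⟩
        · by_cases hk0 : k < 0
          · obtain ⟨rfl, e⟩ := hkneg hmθ hk0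
            by_cases hn1 : n = -1
            · left
              refine ⟨⟨hs, ?_⟩, by simp [hmn, hn1]⟩
              change m.1 - _ • θ ∈ _
              rw [e]
              have := hθ.2 _ (hΦ.neg_mem hm)
              rwa [sub_neg_eq_add, add_comm] at this
            · exact Or.inr ⟨hs, n - -1, by omega, by simp [hmn]⟩
          · exact Or.inr ⟨hs, n - k, by omega, by simp [hmn]⟩
  value_pos x hx m hm := by
    have hx' : ∀ γ ∈ Δ, 0 < ⟪γ, x⟫ := fun γ hγ => by
      simpa [value] using hx (γ, 0) (Or.inl ⟨hγ, rfl⟩)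
    rcases hm with hm | ⟨hm, n, hn, hmn⟩
    · simpa [value, hm.2] using inner_pos_of_mem_cone hx' hm.1.2 (hΦ.ne_zero hm.1.1)
    · have h1 : ⟪θ, x⟫ < 1 := by
        have := hx (-θ, -1) (Or.inr rfl)
        simp only [value, inner_neg_left] at this
        linarith
      have h2 := inner_nonneg_of_mem_cone hx' (hθ.2 _ (hΦ.neg_mem hm))
      rw [sub_neg_eq_add, inner_add_left] at h2
      have : (n : ℝ) ≤ -1 := by exact_mod_cast hn
      rw [value, hmn]
      linarith

theorem value_pos_of_mem_region_finiteSetting {x : V} (hx : x ∈ (finiteSetting Φ Δ).region)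
    {l : V × ℝ} (hl : l ∈ (finiteSetting Φ Δ).simple) : 0 < value l x := by
  have := hx l.1 hl.1
  rwa [value, hl.2, sub_zero]

theorem value_pos_of_mem_region_affineSetting (hΦ : IsIrreducibleRootSystem Φ)
    (hΔ : IsSimpleSystem Φ Δ) {θ : V} (hθ : IsHighestRoot Φ Δ θ) {x : V}
    (hx : x ∈ (affineSetting Φ Δ θ).region) {l : V × ℝ} (hl : l ∈ (affineSetting Φ Δ θ).simple) :
    0 < value l x := by
  rcases hl with hl | rfl
  · have := (hx l.1 ⟨hΔ.subset hl.1, subset_cone hl.1⟩).1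
    rwa [value, hl.2, sub_zero, real_inner_comm]
  · have := (hx θ ⟨hθ.1, IsHighestRoot.mem_cone hΦ hθ⟩).2
    rw [value, inner_neg_left, real_inner_comm]
    linarith

end RootSystems

/-! ### Cancellation over the orbit -/

section Orbit

variable {V : Type*} [NormedAddCommGroup V] [InnerProductSpace ℝ V] {D : Setting V}
  {I A : Set (V × ℝ)} {l : V × ℝ}

theorem Setting.subset_pos_of_mem_orbit (hA : A ∈ D.orbit I) : A ⊆ D.pos := by
  obtain ⟨w, hw, rfl⟩ := hA
  exact hw.2

namespace Setting.IsReflectionSystem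

theorem act_image_subset_pos (hD : D.IsReflectionSystem) (hl : l ∈ D.simple) (hA : A ⊆ D.pos)
    (hlA : l ∉ A) : act (affineReflection l) '' A ⊆ D.pos := by
  rintro _ ⟨m, hm, rfl⟩
  exact hD.act_mem l hl m (hA hm) fun h => hlA (h ▸ hm)

theorem notMem_act_image (hD : D.IsReflectionSystem) (hl : l ∈ D.simple) (hA : A ⊆ D.pos) :
    l ∉ act (affineReflection l) '' A := by
  rintro ⟨m, hm, h⟩
  have : m = -l := by
    rw [← act_affineReflection_self (hD.fst_ne_zero l hl)]
    exact ((act_affineReflection_involutive l).eq_iff.1 h)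
  exact hD.neg_notMem l (hD.simple_subset hl) (this ▸ hA hm)

theorem act_image_mem_orbit (hD : D.IsReflectionSystem) (hl : l ∈ D.simple) (hA : A ∈ D.orbit I)
    (hlA : l ∉ A) : act (affineReflection l) '' A ∈ D.orbit I := by
  have hs := hD.act_image_subset_pos hl (subset_pos_of_mem_orbit hA) hlA
  obtain ⟨w, hw, rfl⟩ := hA
  have e : act (affineReflection l * w) '' I = act (affineReflection l) '' (act w '' I) := by
    rw [Set.image_image]
    simp only [act_mul]
  exact ⟨affineReflection l * w, ⟨D.group.mul_mem (hD.reflection_mem l hl) hw.1, e ▸ hs⟩, e⟩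

theorem orbitSign_act_image [FiniteDimensional ℝ V] (hD : D.IsReflectionSystem)
    (h2 : ∀ w ∈ D.group, act w '' I = I → sign w = 1) (hl : l ∈ D.simple) (hA : A ∈ D.orbit I)
    (hlA : l ∉ A) : D.orbitSign I (act (affineReflection l) '' A) = - D.orbitSign I A := by
  have hs := hD.act_image_subset_pos hl (subset_pos_of_mem_orbit hA) hlA
  obtain ⟨w, hw, rfl⟩ := hA
  have e : act (affineReflection l * w) '' I = act (affineReflection l) '' (act w '' I) := by
    rw [Set.image_image]
    simp only [act_mul]
  rw [← e, D.orbitSign_eq I h2 _ ⟨D.group.mul_mem (hD.reflection_mem l hl) hw.1, e ▸ hs⟩,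
    D.orbitSign_eq I h2 w hw, sign_mul, sign_affineReflection (hD.fst_ne_zero l hl), neg_one_mul]

/-- The sign-reversing involution `A ↦ s_l A` makes signed sums over `s_l`-stable families of sets
not containing `l` vanish. -/
theorem sum_orbitSign_mul_eq_zero [FiniteDimensional ℝ V] (hD : D.IsReflectionSystem)
    (h2 : ∀ w ∈ D.group, act w '' I = I → sign w = 1) (hl : l ∈ D.simple)
    (T : Finset (Set (V × ℝ))) (hT : ∀ A ∈ T, A ∈ D.orbit I ∧ l ∉ A)
    (hTl : ∀ A ∈ T, act (affineReflection l) '' A ∈ T) (p : Set (V × ℝ) → ℝ)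
    (hp : ∀ A ∈ T, p (act (affineReflection l) '' A) = p A) :
    ∑ A ∈ T, D.orbitSign I A * p A = 0 := by
  have hsum : ∀ A ∈ T, D.orbitSign I A * p A + D.orbitSign I (act (affineReflection l) '' A) *
      p (act (affineReflection l) '' A) = 0 := fun A hA => by
    rw [hp A hA, hD.orbitSign_act_image h2 hl (hT A hA).1 (hT A hA).2]
    ring
  refine Finset.sum_involution (fun A _ => act (affineReflection l) '' A) hsum ?_ hTl ?_
  · intro A hA h0 h
    have := hsum A hA
    rw [h] at this
    exact h0 (by linarith)
  · intro A _
    rw [Set.image_image]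
    simp only [act_affineReflection_involutive l _, Set.image_id']

/-- The signs of the orbit sum to `1`: the sets that miss some element of the set `J` of (C1) cancel
in pairs, and `I` is the only set that contains `J`. -/
theorem sum_orbitSign [FiniteDimensional ℝ V] (hD : D.IsReflectionSystem) (hI : I ⊆ D.pos)
    (hcons : D.IsConsistent I) : ∑ A ∈ hcons.c3.toFinset, D.orbitSign I A = 1 := by
  classical
  obtain ⟨J, hJ, hperp, huniq⟩ := hcons.c1
  have hfin : J.Finite := hD.finite_simple.subset fun l hl => (hJ hl).1
  have hone : (1 : V ≃ᵃⁱ[ℝ] V) ∈ D.keep I ∧ act (1 : V ≃ᵃⁱ[ℝ] V) '' I = I := by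
    have : act (1 : V ≃ᵃⁱ[ℝ] V) '' I = I := by simp [act_one]
    exact ⟨⟨D.group.one_mem, by rwa [this]⟩, this⟩
  have key : ∀ K : Finset (V × ℝ), (K : Set (V × ℝ)) ⊆ J →
      ∑ A ∈ hcons.c3.toFinset with (K : Set (V × ℝ)) ⊆ A, D.orbitSign I A =
        ∑ A ∈ hcons.c3.toFinset, D.orbitSign I A := by
    intro K
    induction K using Finset.induction_on with
    | empty => simp
    | insert l K hlK ih =>
      intro hK
      rw [Finset.coe_insert, Set.insert_subset_iff] at hK
      rw [← ih hK.2, ← Finset.sum_filter_add_sum_filter_not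
        {A ∈ hcons.c3.toFinset | (K : Set (V × ℝ)) ⊆ A} (fun A => l ∈ A),
        Finset.filter_filter, Finset.filter_filter]
      have hl := (hJ hK.1).1
      have h0 := hD.sum_orbitSign_mul_eq_zero (I := I) hcons.c2 hl
        {A ∈ hcons.c3.toFinset | (K : Set (V × ℝ)) ⊆ A ∧ l ∉ A} (by simp +contextual)
        (fun A hA => by
          simp only [Finset.mem_filter, Set.Finite.mem_toFinset] at hA ⊢
          refine ⟨hD.act_image_mem_orbit hl hA.1 hA.2.2, fun m hm => ⟨m, hA.2.1 hm, ?_⟩,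
            hD.notMem_act_image hl (subset_pos_of_mem_orbit hA.1)⟩
          -- `s_l` fixes the elements of `J` orthogonal to `l`
          exact act_affineReflection_of_perp (hD.fst_ne_zero l hl)
            (hperp hK.1 (hK.2 hm) fun h => hlK (h ▸ hm)))
        (fun _ => 1) (fun _ _ => rfl)
      simp only [mul_one] at h0
      rw [h0, add_zero]
      refine Finset.sum_congr (Finset.filter_congr fun A _ => ?_) fun _ _ => rfl
      rw [Finset.coe_insert, Set.insert_subset_iff, and_comm]
  rw [← key hfin.toFinset (by simp), Set.Finite.coe_toFinset]
  have : {A ∈ hcons.c3.toFinset | J ⊆ A} = {I} := by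
    ext A
    simp only [Finset.mem_filter, Set.Finite.mem_toFinset, Finset.mem_singleton]
    refine ⟨fun h => huniq A h.1 h.2, ?_⟩
    rintro rfl
    exact ⟨⟨1, hone⟩, fun l hl => (hJ hl).2⟩
  rw [this, Finset.sum_singleton]
  have h1 := D.orbitSign_eq I hcons.c2 1 hone.1
  rw [hone.2] at h1
  rw [h1]
  exact hcons.c2 1 D.group.one_mem hone.2

end Setting.IsReflectionSystem

end Orbit

/-! ### First zeros of continuous functions and stopping times -/

section FirstZero

/-- A countable dense set of times containing `0`. -/
def timeSet : Set ℝ≥0 := insert 0 (Set.range (TopologicalSpace.denseSeq ℝ≥0))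

theorem countable_timeSet : timeSet.Countable := (Set.countable_range _).insert 0

instance : Countable timeSet := countable_timeSet

theorem dense_timeSet : Dense timeSet :=
  (TopologicalSpace.denseRange_denseSeq ℝ≥0).mono (Set.subset_insert _ _)

theorem exists_mem_timeSet_le (t : ℝ≥0) {ε : ℝ≥0} (hε : 0 < ε) :
    ∃ q ∈ timeSet, q ≤ t ∧ t < q + ε := by
  rcases eq_zero_or_pos t with rfl | ht
  · exact ⟨0, Set.mem_insert _ _, le_rfl, by simpa using hε⟩
  · obtain ⟨q, hq, h1, h2⟩ := dense_timeSet.exists_between (tsub_lt_self ht hε)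
    exact ⟨q, hq, h2.le, lt_add_of_tsub_lt_right h1⟩

theorem exists_zero_of_forall_small {h : ℝ≥0 → ℝ} (hc : Continuous h) {t : ℝ≥0}
    (H : ∀ n : ℕ, ∃ q ≤ t, |h q| < 1 / (n + 1)) : ∃ s ≤ t, h s = 0 := by
  obtain ⟨s, hs, hmin⟩ := (isCompact_Icc (a := (0 : ℝ≥0)) (b := t)).exists_isMinOn
    ⟨0, by simp⟩ hc.abs.continuousOn
  refine ⟨s, hs.2, abs_eq_zero.1 (le_antisymm (le_of_forall_pos_le_add fun ε hε => ?_)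
    (abs_nonneg _))⟩
  obtain ⟨n, hn⟩ := exists_nat_one_div_lt hε
  obtain ⟨q, hq, hqn⟩ := H n
  have : |h s| ≤ |h q| := hmin ⟨zero_le, hq⟩
  linarith

theorem exists_small_of_zero {h : ℝ≥0 → ℝ} (hc : Continuous h) {s : ℝ≥0} (hs : h s = 0)
    {ε : ℝ} (hε : 0 < ε) : ∃ q ∈ timeSet, q ≤ s ∧ |h q| < ε := by
  obtain ⟨δ, hδ, H⟩ := Metric.continuousAt_iff.1 (hc.continuousAt (x := s)) ε hε
  obtain ⟨q, hq, h1, h2⟩ := exists_mem_timeSet_le s (ε := ⟨δ, hδ.le⟩) hδ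
  refine ⟨q, hq, h1, ?_⟩
  have : dist q s < δ := by
    rw [NNReal.dist_eq, abs_sub_comm, abs_of_nonneg (sub_nonneg.2 (by exact_mod_cast h1))]
    have : (s : ℝ) < q + δ := by exact_mod_cast h2
    linarith
  simpa [Real.dist_eq, hs] using H this

/-- Uniform continuity of `h` on the countable set of times up to `q`. -/
def RegularUpTo (h : ℝ≥0 → ℝ) (q : ℝ≥0) : Prop :=
  ∀ n : ℕ, ∃ m : ℕ, ∀ a b : timeSet, (a : ℝ≥0) ≤ q → (b : ℝ≥0) ≤ q →
    |(a : ℝ) - b| < 1 / (m + 1) → |h a - h b| < 1 / (n + 1)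

/-- The function `h`, observed at countably many times, comes arbitrarily close to `0` by time `t`
while it is still uniformly continuous. -/
def ApproachesZeroBy (h : ℝ≥0 → ℝ) (t : ℝ≥0) : Prop :=
  ∀ n : ℕ, ∃ q : timeSet, (q : ℝ≥0) ≤ t ∧ RegularUpTo h q ∧ |h q| < 1 / (n + 1)

theorem RegularUpTo.mono {h : ℝ≥0 → ℝ} {q r : ℝ≥0} (hr : RegularUpTo h r) (hqr : q ≤ r) :
    RegularUpTo h q := fun n => by
  obtain ⟨m, hm⟩ := hr n
  exact ⟨m, fun a b ha hb => hm a b (ha.trans hqr) (hb.trans hqr)⟩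

theorem regularUpTo_of_continuous {h : ℝ≥0 → ℝ} (hc : Continuous h) (q : ℝ≥0) :
    RegularUpTo h q := fun n => by
  have := (isCompact_Icc (a := (0 : ℝ≥0)) (b := q)).uniformContinuousOn_of_continuous
    hc.continuousOn
  obtain ⟨δ, hδ, H⟩ := Metric.uniformContinuousOn_iff.1 this (1 / (n + 1)) (by positivity)
  obtain ⟨m, hm⟩ := exists_nat_one_div_lt hδ
  refine ⟨m, fun a b ha hb hab => ?_⟩
  have := H a ⟨zero_le, ha⟩ b ⟨zero_le, hb⟩
    (by rw [NNReal.dist_eq]; exact hab.trans hm)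
  rwa [Real.dist_eq] at this

theorem ApproachesZeroBy.mono {h : ℝ≥0 → ℝ} {s t : ℝ≥0} (hs : ApproachesZeroBy h s)
    (hst : s ≤ t) : ApproachesZeroBy h t := fun n => by
  obtain ⟨q, h1, h2⟩ := hs n
  exact ⟨q, h1.trans hst, h2⟩

theorem approachesZeroBy_iff {h : ℝ≥0 → ℝ} (hc : Continuous h) {t : ℝ≥0} :
    ApproachesZeroBy h t ↔ ∃ s ≤ t, h s = 0 := by
  refine ⟨fun H => exists_zero_of_forall_small hc fun n => ?_, fun ⟨s, hst, hs⟩ n => ?_⟩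
  · obtain ⟨q, h1, -, h2⟩ := H n
    exact ⟨q, h1, h2⟩
  · obtain ⟨q, hq, h1, h2⟩ := exists_small_of_zero hc hs (ε := 1 / (n + 1)) (by positivity)
    exact ⟨⟨q, hq⟩, h1.trans hst, regularUpTo_of_continuous hc q, h2⟩

/-- Right-continuity in `t`. If `h` is uniformly continuous up to some time beyond `t`, small values
just after `t` force small values up to `t`; otherwise only times up to `t` count. -/
theorem approachesZeroBy_of_forall_gt {h : ℝ≥0 → ℝ} {t : ℝ≥0}
    (H : ∀ s > t, ApproachesZeroBy h s) : ApproachesZeroBy h t := by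
  by_contra hcon
  simp only [ApproachesZeroBy, not_forall, not_exists, not_and] at hcon
  obtain ⟨n, hn⟩ := hcon
  obtain ⟨q₀, -, hq₀, hq₀n⟩ := H (t + 1) (lt_add_of_pos_right t one_pos) n
  have htq₀ : t < q₀ := lt_of_not_ge fun h' => hn q₀ h' hq₀ hq₀n
  obtain ⟨m, hm⟩ := hq₀ (2 * n + 1)
  have hδ : (0 : ℝ≥0) < 1 / (2 * (m + 1)) := by positivity
  obtain ⟨q, hqs, hq, hqn⟩ := H (min q₀ (t + 1 / (2 * (m + 1))))
    (lt_min htq₀ (lt_add_of_pos_right t hδ)) (2 * n + 1)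
  have e : (1 : ℝ) / ((2 * n + 1 : ℕ) + 1) = 1 / (n + 1) / 2 := by
    push_cast
    field_simp
    ring
  have hpos : (0 : ℝ) < 1 / (n + 1) := by positivity
  rw [e] at hqn
  by_cases hqt : (q : ℝ≥0) ≤ t
  · exact hn q hqt hq (by linarith)
  rw [not_le] at hqt
  obtain ⟨a, ha, hat, hta⟩ := exists_mem_timeSet_le t hδ
  refine hn ⟨a, ha⟩ hat (hq.mono (hat.trans hqt.le)) ?_
  have hclose := hm ⟨a, ha⟩ q (hat.trans htq₀.le) (hqs.trans (min_le_left _ _)) (by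
    have h1 : (q : ℝ) ≤ t + 1 / (2 * (m + 1)) := by
      exact_mod_cast hqs.trans (min_le_right _ _)
    have h2 : (t : ℝ) < a + 1 / (2 * (m + 1)) := by exact_mod_cast hta
    have h3 : (t : ℝ) < q := by exact_mod_cast hqt
    have h4 : (a : ℝ) ≤ t := by exact_mod_cast hat
    have h5 : (1 : ℝ) / (2 * (m + 1)) + 1 / (2 * (m + 1)) = 1 / (m + 1) := by
      field_simp
      ring
    simp only
    rw [abs_sub_comm, abs_of_nonneg (by linarith)]
    linarith)
  rw [e] at hclose
  have := abs_sub_abs_le_abs_sub (h a) (h q)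
  simp only at hclose ⊢
  linarith

theorem measurableSet_approachesZeroBy {Ω : Type*} [MeasurableSpace Ω] {g : ℝ≥0 → Ω → ℝ}
    {t : ℝ≥0} (hg : ∀ q ≤ t, Measurable (g q)) :
    MeasurableSet {ω | ApproachesZeroBy (fun s => g s ω) t} := by
  rw [measurableSet_setOfPred]
  unfold ApproachesZeroBy RegularUpTo
  refine Measurable.forall fun n => Measurable.exists fun q => ?_
  by_cases hq : (q : ℝ≥0) ≤ t
  swap
  · simp [hq]
  refine measurable_const.and (Measurable.and ?_ ?_)
  · refine Measurable.forall fun n => Measurable.exists fun k => Measurable.forall fun a =>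
      Measurable.forall fun b => ?_
    by_cases ha : (a : ℝ≥0) ≤ q
    swap
    · simp [ha]
    by_cases hb : (b : ℝ≥0) ≤ q
    swap
    · simp [hb]
    refine measurable_const.imp (measurable_const.imp (measurable_const.imp ?_))
    exact measurableSet_setOfPred.1 (measurableSet_lt
      (continuous_abs.measurable.comp ((hg a (ha.trans hq)).sub (hg b (hb.trans hq))))
      measurable_const)
  · exact measurableSet_setOfPred.1 (measurableSet_lt
      (continuous_abs.measurable.comp (hg q hq)) measurable_const)

/-- For an adapted real process there is a stopping time of the raw filtration which is the first
zero along each continuous path. As paths need not all be continuous and the filtration is neither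
completed nor right-continuous, the hitting time itself need not be a stopping time. -/
theorem exists_isStoppingTime_first_zero {Ω : Type*} {m : MeasurableSpace Ω}
    (F : Filtration ℝ≥0 m) (g : ℝ≥0 → Ω → ℝ) (hg : ∀ t, Measurable[F t] (g t)) :
    ∃ τ : Ω → WithTop ℝ≥0, IsStoppingTime F τ ∧
      ∀ ω, Continuous (fun t => g t ω) → ∀ t : ℝ≥0, τ ω ≤ t ↔ ∃ s ≤ t, g s ω = 0 := by
  classical
  let K : Ω → Set ℝ≥0 := fun ω => {t | ApproachesZeroBy (fun s => g s ω) t}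
  let τ : Ω → WithTop ℝ≥0 := fun ω => if (K ω).Nonempty then ((sInf (K ω) : ℝ≥0) : WithTop ℝ≥0)
    else ⊤
  have hτ (ω : Ω) (t : ℝ≥0) : τ ω ≤ t ↔ t ∈ K ω := by
    by_cases hne : (K ω).Nonempty
    · simp only [τ, if_pos hne, WithTop.coe_le_coe]
      refine ⟨fun h => ApproachesZeroBy.mono (approachesZeroBy_of_forall_gt fun s hs => ?_) h,
        fun h => csInf_le (OrderBot.bddBelow _) h⟩
      obtain ⟨r, hr, hrs⟩ := exists_lt_of_csInf_lt hne hs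
      exact ApproachesZeroBy.mono hr hrs.le
    · simp only [τ, if_neg hne, top_le_iff, WithTop.coe_ne_top, false_iff]
      exact fun h => hne ⟨t, h⟩
  refine ⟨τ, fun t => ?_, fun ω hc t => (hτ ω t).trans (approachesZeroBy_iff hc)⟩
  have hset : {ω | τ ω ≤ t} = {ω | ApproachesZeroBy (fun s => g s ω) t} := by
    ext ω
    exact hτ ω t
  rw [hset]
  exact @measurableSet_approachesZeroBy _ (F t) g t fun q hq => (hg q).mono (F.mono hq) le_rfl

end FirstZero

/-! ### Hitting times of continuous paths -/

section HittingTimes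

variable {V : Type*} [NormedAddCommGroup V] [InnerProductSpace ℝ V] {Ω : Type*}
  {X : ℝ≥0 → Ω → V} {ω : Ω}

theorem hitTime_le_of_value_eq_zero {l : V × ℝ} {s : ℝ≥0} (h : value l (X s ω) = 0) :
    hitTime X l ω ≤ s :=
  iInf₂_le s h

theorem hitTime_le_iff (hc : Continuous (path X ω)) {l : V × ℝ} {t : ℝ≥0} :
    hitTime X l ω ≤ t ↔ ∃ s ≤ t, value l (X s ω) = 0 := by
  refine ⟨fun h => ?_, fun ⟨s, hst, hs⟩ =>
    (hitTime_le_of_value_eq_zero hs).trans (by exact_mod_cast hst)⟩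
  have hclosed : IsClosed {s | value l (X s ω) = 0} :=
    isClosed_singleton.preimage ((continuous_value l).comp hc)
  rcases Set.eq_empty_or_nonempty {s | value l (X s ω) = 0} with he | hne
  · have : hitTime X l ω = ⊤ := by
      rw [hitTime]
      refine iInf₂_eq_top.2 fun s hs => ?_
      exact absurd hs (Set.eq_empty_iff_forall_notMem.1 he s)
    rw [this] at h
    exact absurd h (by simp)
  · refine ⟨_, ?_, hclosed.csInf_mem hne (OrderBot.bddBelow _)⟩
    have : ((sInf {s | value l (X s ω) = 0} : ℝ≥0) : ℝ≥0∞) ≤ hitTime X l ω :=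
      le_iInf₂ fun s hs => ENNReal.coe_le_coe.2 (csInf_le (OrderBot.bddBelow _) hs)
    exact_mod_cast this.trans h

/-- A version of the hitting time of the hyperplane of `l` that looks at a path at countably many
times only, and hence is measurable on path space. -/
def regularHitTime (l : V × ℝ) (f : ℝ≥0 → V) : ℝ≥0∞ :=
  ⨆ n : ℕ, ⨅ q : timeSet, ⨅ _ : |value l (f q)| < 1 / (n + 1), ((q : ℝ≥0) : ℝ≥0∞)

/-- The minimum of the regular hitting times over `A`. -/
def regularExitTime (A : Set (V × ℝ)) (f : ℝ≥0 → V) : ℝ≥0∞ :=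
  ⨅ l ∈ A, regularHitTime l f

theorem regularHitTime_path (hc : Continuous (path X ω)) (l : V × ℝ) :
    regularHitTime l (path X ω) = hitTime X l ω := by
  have hcl : Continuous fun s => value l (path X ω s) := (continuous_value l).comp hc
  refine le_antisymm (iSup_le fun n => le_iInf₂ fun s hs => ?_) ?_
  · obtain ⟨q, hq, h1, h2⟩ := exists_small_of_zero hcl hs (ε := 1 / (n + 1)) (by positivity)
    exact (iInf₂_le (⟨q, hq⟩ : timeSet) h2).trans (by exact_mod_cast h1)
  · by_contra! hlt
    obtain ⟨c, hc1, hc2⟩ := ENNReal.lt_iff_exists_nnreal_btwn.1 hlt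
    refine hc2.not_ge ((hitTime_le_iff hc).2 (exists_zero_of_forall_small hcl fun n => ?_))
    have := (le_iSup (fun n : ℕ => ⨅ q : timeSet, ⨅ _ : |value l (path X ω q)| < 1 / (n + 1),
      ((q : ℝ≥0) : ℝ≥0∞)) n).trans_lt hc1
    simp only [iInf_lt_iff] at this
    obtain ⟨q, hq, hqc⟩ := this
    exact ⟨q, by exact_mod_cast hqc.le, hq⟩

theorem regularExitTime_path (hc : Continuous (path X ω)) (A : Set (V × ℝ)) :
    regularExitTime A (path X ω) = exitTime X A ω := by
  simp only [regularExitTime, exitTime, regularHitTime_path hc]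

theorem measurable_regularExitTime [FiniteDimensional ℝ V] [MeasurableSpace V] [BorelSpace V]
    {A : Set (V × ℝ)} (hA : A.Countable) : Measurable (regularExitTime A) := by
  refine Measurable.biInf A hA fun l _ => Measurable.iSup fun n => Measurable.iInf fun q => ?_
  have hm : MeasurableSet {f : ℝ≥0 → V | |value l (f q)| < 1 / (n + 1)} :=
    measurableSet_lt (continuous_abs.measurable.comp
      ((continuous_value l).measurable.comp (measurable_pi_apply _))) measurable_const
  classical
  have : (fun f : ℝ≥0 → V => ⨅ _ : |value l (f q)| < 1 / (n + 1), ((q : ℝ≥0) : ℝ≥0∞)) =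
      fun f => if |value l (f q)| < 1 / (n + 1) then ((q : ℝ≥0) : ℝ≥0∞) else ⊤ :=
    funext fun f => by rw [iInf_eq_if]
  rw [this]
  exact Measurable.ite hm measurable_const measurable_const

theorem regularExitTime_affineReflection (l : V × ℝ) (A : Set (V × ℝ)) (f : ℝ≥0 → V) :
    regularExitTime A (fun s => affineReflection l (f s)) =
      regularExitTime (act (affineReflection l) '' A) f := by
  simp only [regularExitTime, iInf_image, regularHitTime, value_affineReflection]

theorem measurable_affineReflection_comp [MeasurableSpace V] [BorelSpace V]
    (l : V × ℝ) :
    Measurable fun (f : ℝ≥0 → V) (s : ℝ≥0) => affineReflection l (f s) :=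
  measurable_pi_lambda _ fun s =>
    (affineReflection l).continuous.measurable.comp (measurable_pi_apply s)

variable {D : Setting V}

/-- A continuous path started where all simple roots are positive meets the hyperplane of a positive
root no sooner than that of some simple root. -/
theorem exitTime_simple_le_hitTime (hD : D.IsReflectionSystem) (hc : Continuous (path X ω))
    (h0 : ∀ l ∈ D.simple, 0 < value l (X 0 ω)) {m : V × ℝ} (hm : m ∈ D.pos) :
    exitTime X D.simple ω ≤ hitTime X m ω := by
  refine le_iInf₂ fun s hs => ?_
  by_contra! hlt
  refine (hD.value_pos (X s ω) (fun l hl => ?_) m hm).ne' hs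
  by_contra! hneg
  obtain ⟨u, hu, hu0⟩ := intermediate_value_Icc' (zero_le (a := s))
    (f := fun u => value l (X u ω)) ((continuous_value l).comp hc).continuousOn
    ⟨hneg, (h0 l hl).le⟩
  have : exitTime X D.simple ω ≤ u := (iInf₂_le l hl).trans (hitTime_le_of_value_eq_zero hu0)
  exact (hlt.trans_le (this.trans (by exact_mod_cast hu.2))).false

theorem exitTime_simple_le_exitTime (hD : D.IsReflectionSystem) (hc : Continuous (path X ω))
    (h0 : ∀ l ∈ D.simple, 0 < value l (X 0 ω)) {A : Set (V × ℝ)} (hA : A ⊆ D.pos) :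
    exitTime X D.simple ω ≤ exitTime X A ω :=
  le_iInf₂ fun _ hm => exitTime_simple_le_hitTime hD hc h0 (hA hm)

/-- If no hyperplane of `A` is met before time `r`, the exit time is `r` plus the exit time of the
path after `r`. -/
theorem exitTime_eq_add {r : ℝ≥0} {A : Set (V × ℝ)} (h : ∀ m ∈ A, r ≤ hitTime X m ω) :
    exitTime X A ω = r + exitTime (fun s ω => X (r + s) ω) A ω := by
  rw [exitTime, exitTime, ENNReal.add_iInf₂]
  refine iInf_congr fun m => iInf_congr fun hm => ?_
  rw [hitTime, hitTime, ENNReal.add_iInf₂]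
  refine le_antisymm (le_iInf₂ fun s hs => ?_) (le_iInf₂ fun s hs => ?_)
  · exact (iInf₂_le (r + s) hs).trans (by simp)
  · have hrs : r ≤ s := by
      exact_mod_cast (h m hm).trans (hitTime_le_of_value_eq_zero hs)
    refine (iInf₂_le (s - r) (by rwa [add_tsub_cancel_of_le hrs])).trans ?_
    exact_mod_cast (add_tsub_cancel_of_le hrs).le

end HittingTimes

/-! ### Reflection at a stopping time -/

section ReflectionPrinciple

variable {V : Type*} [NormedAddCommGroup V] [InnerProductSpace ℝ V] [FiniteDimensional ℝ V]
  [MeasurableSpace V] [BorelSpace V] {Ω : Type*} [MeasurableSpace Ω]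
  {W : Subgroup (V ≃ᵃⁱ[ℝ] V)} {P : Kernel V Ω} {X : ℝ≥0 → Ω → V}

/-- The path of `X` after the random time `τ`. -/
def pathAfter (X : ℝ≥0 → Ω → V) (τ : Ω → WithTop ℝ≥0) (ω : Ω) : ℝ≥0 → V :=
  fun s => X ((τ ω).untopA + s) ω

/-- The process need not be jointly measurable, but it is almost surely equal to a process all of
whose paths are continuous. -/
theorem IsReflectable.aemeasurable_pathAfter (hX : IsReflectable W P X) (x : V)
    {τ : Ω → WithTop ℝ≥0} (hτ : Measurable fun ω => (τ ω).untopA) :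
    AEMeasurable (pathAfter X τ) (P x) := by
  classical
  obtain ⟨N, hN, hNm, hN0⟩ := exists_measurable_superset_of_null (ae_iff.1 (hX.continuous x))
  let Z : ℝ≥0 → Ω → V := fun t ω => if ω ∈ N then 0 else X t ω
  have hZ : Measurable (Function.uncurry Z) := by
    refine measurable_uncurry_of_continuous_of_measurable (fun ω => ?_) fun t =>
      Measurable.ite hNm measurable_const (hX.measurable t)
    by_cases h : ω ∈ N
    · simp only [Z, if_pos h]
      fun_prop
    · simp only [Z, if_neg h]
      exact not_not.1 fun h' => h (hN h')
  refine ⟨fun ω s => Z ((τ ω).untopA + s) ω, measurable_pi_lambda _ fun s => ?_, ?_⟩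
  · exact hZ.comp ((hτ.add_const s).prodMk measurable_id)
  · filter_upwards [measure_eq_zero_iff_ae_notMem.1 hN0] with ω hω
    funext s
    simp only [Z, if_neg hω, pathAfter]

/-- Reflection principle: on an event `B` prior to the stopping time `τ` on which the process at
time `τ` is on the hyperplane of `l`, the path after `τ` may be reflected by `s_l` without changing
its joint law with `τ`. -/
theorem IsReflectable.measure_inter_reflect (hX : IsReflectable W P X) [IsMarkovKernel P] {x : V}
    {l : V × ℝ} (hl : affineReflection l ∈ W) {τ : Ω → WithTop ℝ≥0}
    (hτ : IsStoppingTime (Filtration.natural X fun t => (hX.measurable t).stronglyMeasurable) τ)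
    {B : Set Ω} (hB : MeasurableSet[hτ.measurableSpace] B) (hBtop : ∀ ω ∈ B, τ ω ≠ ⊤)
    (hBl : ∀ᵐ ω ∂(P x), ω ∈ B → value l (X (τ ω).untopA ω) = 0)
    {S : Set (ℝ≥0 × (ℝ≥0 → V))} (hS : MeasurableSet S) :
    P x (B ∩ {ω | ((τ ω).untopA, pathAfter X τ ω) ∈ S}) =
      P x (B ∩ {ω | ((τ ω).untopA, fun s => affineReflection l (pathAfter X τ ω s)) ∈ S}) := by
  have hBm : MeasurableSet B := hτ.measurableSpace_le _ hB
  have hτm : Measurable[hτ.measurableSpace] fun ω => (τ ω).untopA := hτ.measurable.untopA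
  have hτm' : Measurable fun ω => (τ ω).untopA := hτm.mono hτ.measurableSpace_le le_rfl
  have hY := (hX.aemeasurable_pathAfter x hτm').mono_measure
    (Measure.restrict_le_self (μ := P x) (s := B))
  have hsY : AEMeasurable (fun ω s => affineReflection l (pathAfter X τ ω s)) ((P x).restrict B) :=
    (measurable_affineReflection_comp l).comp_aemeasurable hY
  have h1 := hτm'.aemeasurable.prodMk hY
  have h2 := hτm'.aemeasurable.prodMk hsY
  have key : ((P x).restrict B).map (fun ω => ((τ ω).untopA, pathAfter X τ ω)) =
      ((P x).restrict B).map
        (fun ω => ((τ ω).untopA, fun s => affineReflection l (pathAfter X τ ω s))) := by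
    refine Measure.ext_prod fun {R G} hR hG => ?_
    have hG' := measurable_affineReflection_comp l hG
    have hBR : MeasurableSet[hτ.measurableSpace] (B ∩ {ω | (τ ω).untopA ∈ R}) :=
      MeasurableSet.inter hB (hτm hR)
    have hBRm := hτ.measurableSpace_le _ hBR
    have hsm := fun {G : Set (ℝ≥0 → V)} (hG : MeasurableSet G) =>
      hX.strongMarkov τ hτ _ hBR (fun ω hω => hBtop ω hω.1) G hG x
    rw [Measure.map_apply_of_aemeasurable h1 (hR.prod hG),
      Measure.map_apply_of_aemeasurable h2 (hR.prod hG), Measure.restrict_apply' hBm,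
      Measure.restrict_apply' hBm]
    have e1 : (fun ω => ((τ ω).untopA, pathAfter X τ ω)) ⁻¹' R ×ˢ G ∩ B =
        B ∩ {ω | (τ ω).untopA ∈ R} ∩ {ω | (fun s => X ((τ ω).untopA + s) ω) ∈ G} := by
      ext ω
      simp only [Set.mem_inter_iff, Set.mem_preimage, Set.mem_prod, Set.mem_ofPred_eq]
      tauto
    have e2 : (fun ω => ((τ ω).untopA, fun s => affineReflection l (pathAfter X τ ω s))) ⁻¹'
          R ×ˢ G ∩ B =
        B ∩ {ω | (τ ω).untopA ∈ R} ∩ {ω | (fun s => X ((τ ω).untopA + s) ω) ∈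
          (fun (f : ℝ≥0 → V) (s : ℝ≥0) => affineReflection l (f s)) ⁻¹' G} := by
      ext ω
      simp only [Set.mem_inter_iff, Set.mem_preimage, Set.mem_prod, Set.mem_ofPred_eq, pathAfter]
      tauto
    rw [e1, e2, hsm hG, hsm hG']
    refine lintegral_congr_ae ((ae_restrict_iff' hBRm).2 ?_)
    filter_upwards [hBl] with ω hω hωB
    -- the law started on the hyperplane of `l` is invariant under `s_l`
    have hinv := hX.invariant _ hl (X (τ ω).untopA ω)
    rw [affineReflection_of_value_eq_zero (hω hωB.1)] at hinv
    have hpath : Measurable (path X) := measurable_pi_lambda _ hX.measurable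
    have := congrArg (fun μ => μ G) hinv
    have hspath : Measurable fun ω s => affineReflection l (X s ω) :=
      (measurable_affineReflection_comp l).comp hpath
    rw [Measure.map_apply hspath hG, Measure.map_apply hpath hG] at this
    exact this.symm
  have := congrArg (fun μ => μ S) key
  rw [Measure.map_apply_of_aemeasurable h1 hS, Measure.map_apply_of_aemeasurable h2 hS,
    Measure.restrict_apply' hBm, Measure.restrict_apply' hBm] at this
  rwa [Set.inter_comm B, Set.inter_comm B]

end ReflectionPrinciple

/-! ### The exit probability -/

section ExitProbability

variable {V : Type*} [NormedAddCommGroup V] [InnerProductSpace ℝ V] [FiniteDimensional ℝ V]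
  [MeasurableSpace V] [BorelSpace V] {Ω : Type*} [MeasurableSpace Ω]
  {D : Setting V} {P : Kernel V Ω} {X : ℝ≥0 → Ω → V}

/-- The events `B l` that `l` is the simple root at whose hyperplane a path leaves the fundamental
region, with ties broken by an enumeration of the simple roots, together with the exit time `τ l` on
`B l`. -/
theorem Setting.IsReflectionSystem.exists_exit_wall (hD : D.IsReflectionSystem)
    (hX : ∀ t, Measurable (X t)) :
    ∃ (τ : V × ℝ → Ω → WithTop ℝ≥0) (hτ : ∀ l, IsStoppingTime
        (Filtration.natural X fun t => (hX t).stronglyMeasurable) (τ l)) (B : V × ℝ → Set Ω),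
      (∀ l, MeasurableSet[(hτ l).measurableSpace] (B l)) ∧ (∀ l, ∀ ω ∈ B l, τ l ω ≠ ⊤) ∧
      D.simple.PairwiseDisjoint B ∧ ∀ ω, Continuous (path X ω) →
        (∀ l ∈ D.simple, ω ∈ B l → hitTime X l ω = ((τ l ω).untopA : ℝ≥0) ∧
          exitTime X D.simple ω = ((τ l ω).untopA : ℝ≥0)) ∧
        (exitTime X D.simple ω ≠ ⊤ → ∃ l ∈ D.simple, ω ∈ B l) := by
  obtain ⟨e, he⟩ := Set.countable_iff_exists_injOn.1 hD.finite_simple.countable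
  have hadapt := Filtration.stronglyAdapted_natural fun t => (hX t).stronglyMeasurable
  choose τ hτ hτ0 using fun l : V × ℝ => exists_isStoppingTime_first_zero
    (Filtration.natural X fun t => (hX t).stronglyMeasurable) (fun t ω => value l (X t ω))
    fun t => (continuous_value l).measurable.comp (hadapt t).measurable
  have hle {ω : Ω} (hc : Continuous (path X ω)) (l : V × ℝ) (t : ℝ≥0) :
      τ l ω ≤ t ↔ hitTime X l ω ≤ t :=
    (hτ0 l ω ((continuous_value l).comp hc) t).trans (hitTime_le_iff hc).symm
  have hcoe {ω : Ω} {l : V × ℝ} (h : τ l ω ≠ ⊤) :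
      τ l ω = (((τ l ω).untopA : ℝ≥0) : WithTop ℝ≥0) := by
    rw [WithTop.untopA_eq_untop h, WithTop.coe_untop]
  let B : V × ℝ → Set Ω := fun l => {ω | τ l ω ≠ ⊤} ∩
    ((⋂ m ∈ D.simple, {ω | τ l ω ≤ τ m ω}) ∩
      ⋂ m ∈ {m | m ∈ D.simple ∧ e m < e l}, {ω | τ m ω ≤ τ l ω}ᶜ)
  refine ⟨τ, hτ, B, fun l => ?_, fun l ω h => h.1, ?_, fun ω hc => ⟨fun l hl hω => ?_, ?_⟩⟩
  · refine MeasurableSet.inter ?_ (MeasurableSet.inter ?_ ?_)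
    · exact (hτ l).measurable (measurableSet_singleton ⊤).compl
    · exact MeasurableSet.biInter hD.finite_simple.countable fun m _ =>
        (hτ l).measurableSet_le_stopping_time (hτ m)
    · exact MeasurableSet.biInter (hD.finite_simple.subset fun m hm => hm.1).countable fun m _ =>
        ((hτ m).measurableSet_stopping_time_le (hτ l)).compl
  · have key : ∀ l ∈ D.simple, ∀ m ∈ D.simple, e l < e m → Disjoint (B l) (B m) := by
      intro l hl m hm hlm
      refine Set.disjoint_left.2 fun ω h h' => ?_
      have h1 := Set.mem_iInter₂.1 h.2.1 m hm
      exact Set.mem_iInter₂.1 h'.2.2 l ⟨hl, hlm⟩ h1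
    intro l hl m hm hne
    rcases lt_trichotomy (e l) (e m) with h | h | h
    · exact key l hl m hm h
    · exact absurd (he hl hm h) hne
    · exact (key m hm l hl h).symm
  · have h1 : hitTime X l ω ≤ ((τ l ω).untopA : ℝ≥0) := (hle hc l _).1 (hcoe hω.1).le
    have h2 (m : V × ℝ) (hm : m ∈ D.simple) : ((τ l ω).untopA : ℝ≥0) ≤ hitTime X m ω := by
      by_contra! hlt
      obtain ⟨c, hc1, hc2⟩ := ENNReal.lt_iff_exists_nnreal_btwn.1 hlt
      have := (Set.mem_iInter₂.1 hω.2.1 m hm).trans ((hle hc m c).2 hc1.le)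
      rw [hcoe hω.1, WithTop.coe_le_coe] at this
      exact this.not_gt (by exact_mod_cast hc2)
    have h3 := le_antisymm h1 (h2 l hl)
    exact ⟨h3, le_antisymm ((iInf₂_le l hl).trans h1) (le_iInf₂ h2)⟩
  · intro hne
    have hlt := lt_top_iff_ne_top.2 hne
    simp only [exitTime, iInf_lt_iff] at hlt
    obtain ⟨m, hm, hmt⟩ := hlt
    obtain ⟨l, hl, hmin⟩ := hD.finite_simple.toFinset.exists_min_image
      (fun l => toLex (τ l ω, e l)) ⟨m, hD.finite_simple.mem_toFinset.2 hm⟩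
    simp only [Set.Finite.mem_toFinset, Prod.Lex.le_iff, ofLex_toLex] at hl hmin
    have hmin' (m : V × ℝ) (hm : m ∈ D.simple) : τ l ω ≤ τ m ω :=
      (hmin m hm).elim (fun h => h.le) fun h => h.1.le
    have hm_top : τ m ω ≠ ⊤ := by
      have := (hle hc m (hitTime X m ω).toNNReal).2 (ENNReal.coe_toNNReal hmt.ne).ge
      exact (this.trans_lt (WithTop.coe_lt_top _)).ne
    refine ⟨l, hl, ((hmin' m hm).trans_lt (lt_top_iff_ne_top.2 hm_top)).ne,
      Set.mem_iInter₂.2 hmin', Set.mem_iInter₂.2 fun m hm h => ?_⟩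
    rcases hmin m hm.1 with h' | h'
    · exact h'.not_ge h
    · exact h'.2.not_gt hm.2

/-- The exit probability for a general reflection group with positive and simple roots. -/
theorem Setting.IsReflectionSystem.measureReal_lt_exitTime_simple [IsMarkovKernel P]
    (hD : D.IsReflectionSystem) {I : Set (V × ℝ)} (hI : I ⊆ D.pos) (hcons : D.IsConsistent I)
    (hX : IsReflectable D.group P X) {x : V} (hx : ∀ l ∈ D.simple, 0 < value l x) (t : ℝ≥0) :
    (P x).real {ω | (t : ℝ≥0∞) < exitTime X D.simple ω} =
      ∑ A ∈ hcons.c3.toFinset,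
        D.orbitSign I A * (P x).real {ω | (t : ℝ≥0∞) < exitTime X A ω} := by
  classical
  obtain ⟨τ, hτ, B, hB, hBtop, hdisj, hwall⟩ := hD.exists_exit_wall hX.measurable
  have hgood : ∀ᵐ ω ∂(P x), Continuous (path X ω) ∧ ∀ l ∈ D.simple, 0 < value l (X 0 ω) := by
    filter_upwards [hX.continuous x, hX.start x] with ω h1 h2
    exact ⟨h1, by rwa [h2]⟩
  have hpath : Measurable (path X) := measurable_pi_lambda _ hX.measurable
  have hmeas {A : Set (V × ℝ)} (hA : A ⊆ D.pos) :
      Measurable fun ω => regularExitTime A (path X ω) :=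
    (measurable_regularExitTime (hD.countable_pos.mono hA)).comp hpath
  -- exit at the wall of `l` by time `t`, but no hyperplane of `A` met by then
  let M : V × ℝ → Set (V × ℝ) → Set Ω := fun l A =>
    B l ∩ {ω | regularExitTime D.simple (path X ω) ≤ t ∧ t < regularExitTime A (path X ω)}
  have hMm (l : V × ℝ) {A : Set (V × ℝ)} (hA : A ⊆ D.pos) : MeasurableSet (M l A) :=
    ((hτ l).measurableSpace_le _ (hB l)).inter
      ((measurableSet_le (hmeas hD.simple_subset) measurable_const).inter
        (measurableSet_lt measurable_const (hmeas hA)))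
  have hdecomp {A : Set (V × ℝ)} (hA : A ⊆ D.pos) :
      (P x).real {ω | (t : ℝ≥0∞) < exitTime X A ω} =
        (P x).real {ω | (t : ℝ≥0∞) < exitTime X D.simple ω} +
          ∑ l ∈ hD.finite_simple.toFinset, (P x).real (M l A) := by
    rw [← measureReal_biUnion_finset (fun l hl m hm hne => ?_) fun l _ => hMm l hA]
    swap
    · exact (hdisj (by simpa using hl) (by simpa using hm) hne).mono Set.inter_subset_left
        Set.inter_subset_left
    have h1 : {ω | (t : ℝ≥0∞) < exitTime X D.simple ω} =ᵐ[P x]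
        {ω | (t : ℝ≥0∞) < regularExitTime D.simple (path X ω)} := by
      refine Filter.eventuallyEq_set.2 ?_
      filter_upwards [hgood] with ω hω
      simp only [regularExitTime_path hω.1]
    rw [measureReal_congr h1, ← measureReal_union (h₂ := measure_ne_top _ _)]
    rotate_left
    · refine Set.disjoint_left.2 fun ω h h' => ?_
      obtain ⟨l, -, hl⟩ := Set.mem_iUnion₂.1 h'
      exact hl.2.1.not_gt h
    · exact Finset.measurableSet_biUnion _ fun l _ => hMm l hA
    refine measureReal_congr (Filter.eventuallyEq_set.2 ?_)
    filter_upwards [hgood] with ω hω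
    have hle := exitTime_simple_le_exitTime hD hω.1 hω.2 hA
    simp only [Set.mem_union, Set.mem_iUnion, Set.mem_ofPred_eq, regularExitTime_path hω.1,
      Set.mem_inter_iff, M, Set.Finite.mem_toFinset]
    constructor
    · intro h
      rcases lt_or_ge (t : ℝ≥0∞) (exitTime X D.simple ω) with h' | h'
      · exact Or.inl h'
      · obtain ⟨l, hl, hωl⟩ := (hwall ω hω.1).2 (h'.trans_lt ENNReal.coe_lt_top).ne
        exact Or.inr ⟨l, hl, hωl, h', h⟩
    · rintro (h | ⟨l, -, -, -, h⟩)
      · exact h.trans_le hle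
      · exact h
  have hM_mem {l : V × ℝ} (hl : l ∈ D.simple) {A : Set (V × ℝ)} (hlA : l ∈ A) :
      (P x).real (M l A) = 0 := by
    have : M l A =ᵐ[P x] (∅ : Set Ω) := by
      refine Filter.eventuallyEq_set.2 ?_
      filter_upwards [hgood] with ω hω
      simp only [Set.mem_empty_iff_false, iff_false]
      rintro ⟨h1, h2, h3⟩
      rw [regularExitTime_path hω.1] at h2 h3
      obtain ⟨h4, h5⟩ := (hwall ω hω.1).1 l hl h1
      rw [h5, ← h4] at h2
      exact (h3.trans_le ((iInf₂_le l hlA).trans h2)).false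
    rw [measureReal_congr this, measureReal_empty]
  let S : Set (V × ℝ) → Set (ℝ≥0 × (ℝ≥0 → V)) := fun A =>
    {p | (p.1 : ℝ≥0∞) ≤ t ∧ (t : ℝ≥0∞) < p.1 + regularExitTime A p.2}
  have hS {A : Set (V × ℝ)} (hA : A ⊆ D.pos) : MeasurableSet (S A) := by
    have h1 : Measurable fun p : ℝ≥0 × (ℝ≥0 → V) => (p.1 : ℝ≥0∞) :=
      measurable_fst.coe_nnreal_ennreal
    exact (measurableSet_le h1 measurable_const).inter (measurableSet_lt measurable_const
      (h1.add ((measurable_regularExitTime (hD.countable_pos.mono hA)).comp measurable_snd)))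
  have hMS {l : V × ℝ} (hl : l ∈ D.simple) {A : Set (V × ℝ)} (hA : A ⊆ D.pos) :
      M l A =ᵐ[P x] (B l ∩ {ω | ((τ l ω).untopA, pathAfter X (τ l) ω) ∈ S A} : Set Ω) := by
    refine Filter.eventuallyEq_set.2 ?_
    filter_upwards [hgood] with ω hω
    refine and_congr_right fun hωl => ?_
    obtain ⟨-, h5⟩ := (hwall ω hω.1).1 l hl hωl
    have hcont : Continuous (path (fun s ω' => X ((τ l ω).untopA + s) ω') ω) :=
      hω.1.comp (continuous_const_add _)
    have h6 : exitTime X A ω =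
        ((τ l ω).untopA : ℝ≥0) + regularExitTime A (pathAfter X (τ l) ω) := by
      rw [exitTime_eq_add (r := (τ l ω).untopA) fun m hm => h5 ▸
        exitTime_simple_le_hitTime hD hω.1 hω.2 (hA hm), ← regularExitTime_path hcont]
      rfl
    simp only [Set.mem_ofPred_eq, regularExitTime_path hω.1, h5, h6, S]
  have hM_reflect {l : V × ℝ} (hl : l ∈ D.simple) {A : Set (V × ℝ)} (hA : A ⊆ D.pos)
      (hlA : l ∉ A) : (P x).real (M l (act (affineReflection l) '' A)) = (P x).real (M l A) := by
    have hzero : ∀ᵐ ω ∂(P x), ω ∈ B l → value l (X (τ l ω).untopA ω) = 0 := by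
      filter_upwards [hgood] with ω hω hωl
      obtain ⟨h4, -⟩ := (hwall ω hω.1).1 l hl hωl
      obtain ⟨s, hs, hs0⟩ := (hitTime_le_iff hω.1).1 h4.le
      have : (τ l ω).untopA ≤ s := by
        exact_mod_cast h4 ▸ hitTime_le_of_value_eq_zero hs0
      rwa [le_antisymm hs this] at hs0
    have h := hX.measure_inter_reflect (hD.reflection_mem l hl) (hτ l) (hB l) (hBtop l) hzero
      (hS hA)
    rw [measureReal_congr (hMS hl hA),
      measureReal_congr (hMS hl (hD.act_image_subset_pos hl hA hlA)), measureReal_def,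
      measureReal_def, h]
    simp only [S, Set.mem_ofPred_eq, regularExitTime_affineReflection]
  have hsum {l : V × ℝ} (hl : l ∈ D.simple) :
      ∑ A ∈ hcons.c3.toFinset, D.orbitSign I A * (P x).real (M l A) = 0 := by
    rw [← Finset.sum_filter_add_sum_filter_not _ (fun A => l ∈ A),
      Finset.sum_eq_zero fun A hA => by rw [hM_mem hl (Finset.mem_filter.1 hA).2, mul_zero],
      zero_add]
    have hmem {A : Set (V × ℝ)} (hA : A ∈ hcons.c3.toFinset.filter fun A => l ∉ A) :
        A ∈ D.orbit I ∧ l ∉ A := by simpa using hA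
    refine hD.sum_orbitSign_mul_eq_zero hcons.c2 hl _ (fun A hA => hmem hA) (fun A hA => ?_) _
      fun A hA => hM_reflect hl (subset_pos_of_mem_orbit (hmem hA).1) (hmem hA).2
    have := hmem hA
    rw [Finset.mem_filter, Set.Finite.mem_toFinset]
    exact ⟨hD.act_image_mem_orbit hl this.1 this.2,
      hD.notMem_act_image hl (subset_pos_of_mem_orbit this.1)⟩
  have hcalc : ∀ A ∈ hcons.c3.toFinset,
      D.orbitSign I A * (P x).real {ω | (t : ℝ≥0∞) < exitTime X A ω} =
        D.orbitSign I A * (P x).real {ω | (t : ℝ≥0∞) < exitTime X D.simple ω} +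
          ∑ l ∈ hD.finite_simple.toFinset, D.orbitSign I A * (P x).real (M l A) := fun A hA => by
    rw [hdecomp (subset_pos_of_mem_orbit (hcons.c3.mem_toFinset.1 hA)), mul_add, Finset.mul_sum]
  rw [Finset.sum_congr rfl hcalc, Finset.sum_add_distrib, ← Finset.sum_mul,
    hD.sum_orbitSign hI hcons, one_mul, Finset.sum_comm,
    Finset.sum_eq_zero fun l hl => hsum (hD.finite_simple.mem_toFinset.1 hl), add_zero]

end ExitProbability

end WeylExit

end

theorem theorem7 {V : Type*} [NormedAddCommGroup V] [InnerProductSpace ℝ V]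
    [FiniteDimensional ℝ V] [MeasurableSpace V] [BorelSpace V]
    (Φ Δ : Set V) (hΦ : WeylExit.IsIrreducibleRootSystem Φ) (hΔ : WeylExit.IsSimpleSystem Φ Δ)
    (D : WeylExit.Setting V)
    (hD : D = WeylExit.finiteSetting Φ Δ ∨
      ∃ θ, WeylExit.IsHighestRoot Φ Δ θ ∧ D = WeylExit.affineSetting Φ Δ θ)
    (I : Set (V × ℝ)) (hI : I ⊆ D.pos) (hcons : D.IsConsistent I)
    {Ω : Type*} [MeasurableSpace Ω] (P : Kernel V Ω) [IsMarkovKernel P]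
    (X : ℝ≥0 → Ω → V) (hX : WeylExit.IsReflectable D.group P X)
    (x : V) (hx : x ∈ D.region) (t : ℝ≥0) :
    (P x).real {ω | (t : ℝ≥0∞) < WeylExit.exitTime X D.simple ω} =
      ∑ A ∈ hcons.c3.toFinset,
        D.orbitSign I A * (P x).real {ω | (t : ℝ≥0∞) < WeylExit.exitTime X A ω} := by
  obtain ⟨hsys, hpos⟩ : D.IsReflectionSystem ∧ ∀ l ∈ D.simple, 0 < WeylExit.value l x := by
    rcases hD with rfl | ⟨θ, hθ, rfl⟩
    · exact ⟨WeylExit.isReflectionSystem_finiteSetting hΦ hΔ,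
        fun l hl => WeylExit.value_pos_of_mem_region_finiteSetting hx hl⟩
    · exact ⟨WeylExit.isReflectionSystem_affineSetting hΦ hΔ hθ,
        fun l hl => WeylExit.value_pos_of_mem_region_affineSetting hΦ hΔ hθ hx hl⟩
  exact hsys.measureReal_lt_exitTime_simple hI hcons hX hpos t
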